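/- Let $d\ge 1$ and let $(S(n))_{n\ge0}$ be the simple symmetric nearest-neighbour random walk on $\mathbb Z^d$ started at $0$, with expectation $E$. For $y\in\mathbb Z^d$ let $H(y)=\inf\{n\ge 0: S(n)=y\}$, and for $v:\mathbb Z^d\to[0,\infty)$ put $$e(0,y,v)=E\Big[\exp\Big(-\sum_{n=0}^{H(y)-1}v(S(n))\Big)\mathbf 1_{\{H(y)<\infty\}}\Big].$$ For every $\gamma>0$ let $V_\gamma=(V_\gamma(x))_{x\in\mathbb Z^d}$ be a family of i.i.d. non-negative real random variables; write $\mathbb P$ and $\mathbb E$ for the corresponding probability and expectation. Assume that $V_\gamma(0)/\gamma$ converges in distribution, as $\gamma\searrow0$, to some real random variable $V$ (which is then almost surely non-negative), where $\mathbb E[V]\in[0,\infty]$ may be infinite. Then for every $\gamma>0$ there is exactly one seminorm $\beta_{V_\gamma}$ on $\mathbb R^d$ (the annealed Lyapunov exponent of $V_\gamma$) such that $$\beta_{V_\gamma}(z)=\lim_{k\to\infty}-\frac1k\ln\mathbb E\big[e(0,kz,V_\gamma)\big]\qquad\text{for all } z\in\mathbb Z^d;$$ it is a norm if $\mathbb P[V_\gamma(0)>0]>0$.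 Moreover, for all $\ell\in\mathbb R^d$, $$\liminf_{\gamma\searrow0}\frac{\beta_{V_\gamma}(\ell)}{\sqrt\gamma}\ \ge\ \sqrt{2d\,\mathbb E[V]}\;\|\ell\|_2 ,$$ where the right-hand side is read as $\infty$ if $\mathbb E[V]=\infty$ and $\ell\neq0$, and as $0$ if $\ell=0$. -/

import Mathlib

open MeasureTheory ProbabilityTheory Filter Topology
open scoped ENNReal

noncomputable section

namespace RandomPotential

/-- The step `± e_i` of the nearest-neighbour walk encoded by the pair `(i, ±)`. -/
def step {d : ℕ} (s : Fin d × Bool) : Fin d → ℤ :=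
  Pi.single s.1 (if s.2 then 1 else -1)

/-- The law of the sequence of steps of the simple symmetric random walk on `ℤ^d`, `d ≥ 1`:
the steps are independent and uniformly distributed over the `2d` unit vectors. -/
def walkMeasure (d : ℕ) [NeZero d] : Measure (ℕ → Fin d × Bool) :=
  Measure.infinitePi fun _ => (PMF.uniformOfFintype (Fin d × Bool)).toMeasure

/-- The position `S(n)` of the walk started at `0`. -/
def walk {d : ℕ} (s : ℕ → Fin d × Bool) (n : ℕ) : Fin d → ℤ :=
  ∑ i ∈ Finset.range n, step (s i)

/-- The first passage time `H(y) = inf {n ≥ 0 | S(n) = y}`; it is only meaningful for paths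
that visit `y`, and only used for these. -/
def firstPassage {d : ℕ} (y : Fin d → ℤ) (s : ℕ → Fin d × Bool) : ℕ :=
  sInf {n : ℕ | walk s n = y}

/-- `e(0, y, v) = E[exp(-∑_{n=0}^{H(y)-1} v(S(n))) ; H(y) < ∞]`. -/
def survival {d : ℕ} [NeZero d] (y : Fin d → ℤ) (v : (Fin d → ℤ) → ℝ) : ℝ :=
  ∫ s, {s : ℕ → Fin d × Bool | ∃ n, walk s n = y}.indicator
    (fun s => Real.exp (-∑ n ∈ Finset.range (firstPassage y s), v (walk s n))) s ∂walkMeasure d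

/-- The potential `V = (V(x))_{x ∈ ℤ^d}` consists of i.i.d. non-negative random variables. -/
structure IsIIDPotential {d : ℕ} {Ω : Type*} [MeasurableSpace Ω] (P : Measure Ω)
    (V : (Fin d → ℤ) → Ω → ℝ) : Prop where
  measurable : ∀ x, Measurable (V x)
  nonneg : ∀ x ω, 0 ≤ V x ω
  indep : iIndepFun V P
  identDistrib : ∀ x, IdentDistrib (V x) (V 0) P P

/-- A lattice point as a vector of the Euclidean space `ℝ^d`. -/
def toEuclidean {d : ℕ} (z : Fin d → ℤ) : EuclideanSpace ℝ (Fin d) :=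
  WithLp.toLp 2 fun i => (z i : ℝ)

/-- `p` is the annealed Lyapunov exponent of the potential `V`: a seminorm on `ℝ^d` with
`p(z) = lim_{k → ∞} -(1/k) ln 𝔼[e(0, kz, V)]` for all `z ∈ ℤ^d`. -/
def IsAnnealedExponent {d : ℕ} [NeZero d] {Ω : Type*} [MeasurableSpace Ω] (P : Measure Ω)
    (V : (Fin d → ℤ) → Ω → ℝ) (p : Seminorm ℝ (EuclideanSpace ℝ (Fin d))) : Prop :=
  ∀ z : Fin d → ℤ,
    Tendsto (fun k : ℕ => -1 / (k : ℝ) * Real.log (∫ ω, survival (k • z) (fun x => V x ω) ∂P))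
      atTop (𝓝 (p (toEuclidean z)))

end RandomPotential

end

/-! Averaging over the potential first leaves a single walk with weight `∏ φ(L(z))`, where `L` is
its field of local times and `φ k = 𝔼[exp(-k V_γ(0))]`. This weight depends on the whole past, so
`annealed` is a recursion on the number of steps that carries the local times as an argument;
`IsIIDPotential.integral_survival` identifies its limit with the annealed survival probability. The
inequality `φ j * φ k ≤ φ (j + k)` makes this probability supermultiplicative. Fekete's lemma then
gives the rate on the lattice, and an even, homogeneous, subadditive function on the lattice extends
uniquely to a seminorm.

For the lower bound, cut space into slabs of width `R` orthogonal to a unit vector `θ`. When the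
walk first enters a slab, all sites of the slab and beyond are fresh, so the weight collected there
factors from the past, while later visits to older sites may be counted as free. If `ρ` bounds the
mean weight collected in one slab before its far side is passed, then `j` slabs contribute at most
`ρ ^ j` (`IsSlabMajorant.annealed_le_mul`). Unit slabs with `ρ = φ 1` already show that the exponent
is a norm.

For the asymptotics take `R = K / √γ`. If `m` is the mean of `V_γ(0) / γ` truncated at `M`, then `φ
k ≤ exp(-γ m k + γ² M² k² / 2)`. The linear term is killing at constant rate `γ m`, under which a
slab is crossed with weight about `exp(-√(2dm) K)`; this is read off from a `cosh` supermartingale.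
The quadratic term involves the sum of the squared local times, whose mean in a slab is `O(R³)` in
every dimension, so it contributes `O(γ² R³) = O(√γ)` and vanishes for fixed `K`. A large `K`
absorbs the constant factors, and a large `M` recovers `𝔼[V]`, finite or not
(`isSlabMajorant_slabMajorant`, `rate_mul_norm_le_exponent`, `eventually_mul_norm_le_exponent`). -/

noncomputable section

namespace RandomPotential

variable {d : ℕ}

/-! ### Averages over the steps of the walk -/

/-- The average of `f` over the `2 * d` steps of the walk. -/
def stepAvg (f : Fin d × Bool → ℝ) : ℝ := (2 * (d : ℝ))⁻¹ * ∑ a, f a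

lemma stepAvg_mono {f g : Fin d × Bool → ℝ} (h : ∀ a, f a ≤ g a) : stepAvg f ≤ stepAvg g :=
  mul_le_mul_of_nonneg_left (Finset.sum_le_sum fun a _ => h a) (by positivity)

lemma stepAvg_mul_left (c : ℝ) (f : Fin d × Bool → ℝ) :
    stepAvg (fun a => c * f a) = c * stepAvg f := by
  simp only [stepAvg, ← Finset.mul_sum]; ring

lemma stepAvg_mul_right (c : ℝ) (f : Fin d × Bool → ℝ) :
    stepAvg (fun a => f a * c) = stepAvg f * c := by
  simp only [stepAvg, ← Finset.sum_mul]; ring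

lemma stepAvg_add (f g : Fin d × Bool → ℝ) :
    stepAvg (fun a => f a + g a) = stepAvg f + stepAvg g := by
  simp only [stepAvg, Finset.sum_add_distrib]; ring

lemma stepAvg_sum {ι : Type*} (s : Finset ι) (f : ι → Fin d × Bool → ℝ) :
    stepAvg (fun a => ∑ i ∈ s, f i a) = ∑ i ∈ s, stepAvg (f i) := by
  simp only [stepAvg]
  rw [Finset.sum_comm, Finset.mul_sum]

@[simp]
lemma stepAvg_const [NeZero d] (c : ℝ) : stepAvg (fun _ : Fin d × Bool => c) = c := by
  have : (d : ℝ) ≠ 0 := Nat.cast_ne_zero.2 (NeZero.ne d)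
  simp [stepAvg]
  field_simp

lemma stepAvg_nonneg {f : Fin d × Bool → ℝ} (h : ∀ a, 0 ≤ f a) : 0 ≤ stepAvg f :=
  mul_nonneg (by positivity) (Finset.sum_nonneg fun a _ => h a)

lemma le_stepAvg {f : Fin d × Bool → ℝ} (h : ∀ a, 0 ≤ f a) (a : Fin d × Bool) :
    (2 * (d : ℝ))⁻¹ * f a ≤ stepAvg f :=
  mul_le_mul_of_nonneg_left (Finset.single_le_sum (fun b _ => h b) (Finset.mem_univ a))
    (by positivity)

lemma stepAvg_comp_equiv (e : (Fin d × Bool) ≃ (Fin d × Bool)) (f : Fin d × Bool → ℝ) :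
    stepAvg (fun a => f (e a)) = stepAvg f := by
  simp only [stepAvg]
  rw [Equiv.sum_comp e f]

/-! ### Weights of local times -/

/-- The properties of `k ↦ 𝔼[exp(-k V)]`, `V ≥ 0`, that govern the annealed walk. -/
structure IsLocalWeight (φ : ℕ → ℝ) : Prop where
  zero : φ 0 = 1
  pos : ∀ k, 0 < φ k
  antitone : Antitone φ
  mul_le : ∀ j k, φ j * φ k ≤ φ (j + k)

/-- The weight `∏ φ(L(z))` of the field `L` of local times. -/
def fieldWeight (φ : ℕ → ℝ) (L : (Fin d → ℤ) →₀ ℕ) : ℝ := L.prod fun _ k => φ k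

@[simp]
lemma fieldWeight_zero (φ : ℕ → ℝ) : fieldWeight φ (0 : (Fin d → ℤ) →₀ ℕ) = 1 := by
  simp [fieldWeight]

lemma fieldWeight_add_of_disjoint (φ : ℕ → ℝ) {L L' : (Fin d → ℤ) →₀ ℕ}
    (h : Disjoint L.support L'.support) :
    fieldWeight φ (L + L') = fieldWeight φ L * fieldWeight φ L' := by
  classical
  exact Finsupp.prod_add_index_of_disjoint h _

namespace IsLocalWeight

variable {φ : ℕ → ℝ}

lemma le_one (hφ : IsLocalWeight φ) (k : ℕ) : φ k ≤ 1 := hφ.zero ▸ hφ.antitone (Nat.zero_le k)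

lemma fieldWeight_eq_prod (hφ : IsLocalWeight φ) {L : (Fin d → ℤ) →₀ ℕ} {s : Finset (Fin d → ℤ)}
    (h : L.support ⊆ s) :
    fieldWeight φ L = ∏ z ∈ s, φ (L z) :=
  Finsupp.prod_of_support_subset L h _ fun _ _ => hφ.zero

lemma fieldWeight_pos (hφ : IsLocalWeight φ) (L : (Fin d → ℤ) →₀ ℕ) : 0 < fieldWeight φ L :=
  Finset.prod_pos fun _ _ => hφ.pos _

lemma fieldWeight_anti (hφ : IsLocalWeight φ) {L L' : (Fin d → ℤ) →₀ ℕ} (h : L ≤ L') :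
    fieldWeight φ L' ≤ fieldWeight φ L := by
  rw [hφ.fieldWeight_eq_prod (Finset.Subset.refl L'.support),
    hφ.fieldWeight_eq_prod (Finsupp.support_mono h)]
  exact Finset.prod_le_prod (fun _ _ => (hφ.pos _).le) fun z _ => hφ.antitone (h z)

lemma fieldWeight_le_one (hφ : IsLocalWeight φ) (L : (Fin d → ℤ) →₀ ℕ) : fieldWeight φ L ≤ 1 := by
  rw [← fieldWeight_zero (d := d) φ]
  exact hφ.fieldWeight_anti zero_le

lemma fieldWeight_mul_le (hφ : IsLocalWeight φ) (L L' : (Fin d → ℤ) →₀ ℕ) :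
    fieldWeight φ L * fieldWeight φ L' ≤ fieldWeight φ (L + L') := by
  classical
  rw [hφ.fieldWeight_eq_prod (Finset.subset_union_left (s₂ := L'.support)),
    hφ.fieldWeight_eq_prod (Finset.subset_union_right (s₁ := L.support)),
    hφ.fieldWeight_eq_prod (L := L + L') (Finsupp.support_add), ← Finset.prod_mul_distrib]
  exact Finset.prod_le_prod (fun _ _ => mul_nonneg (hφ.pos _).le (hφ.pos _).le)
    fun z _ => hφ.mul_le _ _

end IsLocalWeight

/-! ### The annealed walk -/

/-- The contribution to `𝔼[exp(-∑ L(z) V(z)) e(x, y, V)]` of the paths from `x` that reach `y`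
within `n` steps, where `φ k = 𝔼[exp(-k V(0))]`. -/
def annealed (φ : ℕ → ℝ) (y : Fin d → ℤ) : ℕ → (Fin d → ℤ) → ((Fin d → ℤ) →₀ ℕ) → ℝ
  | 0, x, L => if x = y then fieldWeight φ L else 0
  | n + 1, x, L => if x = y then fieldWeight φ L else
      stepAvg fun a => annealed φ y n (x + step a) (L + Finsupp.single x 1)

variable {φ : ℕ → ℝ} {y : Fin d → ℤ}

lemma annealed_self (n : ℕ) (L : (Fin d → ℤ) →₀ ℕ) : annealed φ y n y L = fieldWeight φ L := by
  cases n <;> simp [annealed]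

lemma annealed_zero_of_ne {x : Fin d → ℤ} (h : x ≠ y) (L : (Fin d → ℤ) →₀ ℕ) :
    annealed φ y 0 x L = 0 := by simp [annealed, h]

lemma annealed_succ_of_ne {x : Fin d → ℤ} (h : x ≠ y) (n : ℕ) (L : (Fin d → ℤ) →₀ ℕ) :
    annealed φ y (n + 1) x L =
      stepAvg fun a => annealed φ y n (x + step a) (L + Finsupp.single x 1) := by
  simp [annealed, h]

namespace IsLocalWeight

lemma annealed_nonneg (hφ : IsLocalWeight φ) (n : ℕ) (x : Fin d → ℤ) (L : (Fin d → ℤ) →₀ ℕ) :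
    0 ≤ annealed φ y n x L := by
  induction n generalizing x L with
  | zero => rw [annealed]; split_ifs; exacts [(hφ.fieldWeight_pos L).le, le_rfl]
  | succ n ih =>
    rw [annealed]; split_ifs
    exacts [(hφ.fieldWeight_pos L).le, stepAvg_nonneg fun a => ih _ _]

lemma annealed_le_fieldWeight [NeZero d] (hφ : IsLocalWeight φ) (n : ℕ) (x : Fin d → ℤ)
    (L : (Fin d → ℤ) →₀ ℕ) :
    annealed φ y n x L ≤ fieldWeight φ L := by
  induction n generalizing x L with
  | zero => rw [annealed]; split_ifs; exacts [le_rfl, (hφ.fieldWeight_pos L).le]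
  | succ n ih =>
    rw [annealed]; split_ifs
    · exact le_rfl
    · refine (stepAvg_mono fun a => (ih _ _).trans
        (hφ.fieldWeight_anti (le_add_of_nonneg_right zero_le))).trans ?_
      rw [stepAvg_const]

lemma annealed_le_succ (hφ : IsLocalWeight φ) (n : ℕ) (x : Fin d → ℤ) (L : (Fin d → ℤ) →₀ ℕ) :
    annealed φ y n x L ≤ annealed φ y (n + 1) x L := by
  induction n generalizing x L with
  | zero =>
    by_cases h : x = y
    · subst h; rw [annealed_self, annealed_self]
    · rw [annealed_zero_of_ne h]; exact hφ.annealed_nonneg _ _ _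
  | succ n ih =>
    by_cases h : x = y
    · subst h; rw [annealed_self, annealed_self]
    · rw [annealed_succ_of_ne h, annealed_succ_of_ne h]
      exact stepAvg_mono fun a => ih _ _

lemma annealed_monotone (hφ : IsLocalWeight φ) (x : Fin d → ℤ) (L : (Fin d → ℤ) →₀ ℕ) :
    Monotone fun n => annealed φ y n x L :=
  monotone_nat_of_le_succ fun n => hφ.annealed_le_succ n x L

lemma fieldWeight_mul_annealed_le (hφ : IsLocalWeight φ) (n : ℕ) (x : Fin d → ℤ)
    (L L' : (Fin d → ℤ) →₀ ℕ) :
    fieldWeight φ L * annealed φ y n x L' ≤ annealed φ y n x (L + L') := by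
  induction n generalizing x L' with
  | zero =>
    by_cases h : x = y
    · subst h; rw [annealed_self, annealed_self]; exact hφ.fieldWeight_mul_le _ _
    · rw [annealed_zero_of_ne h, annealed_zero_of_ne h, mul_zero]
  | succ n ih =>
    by_cases h : x = y
    · subst h; rw [annealed_self, annealed_self]; exact hφ.fieldWeight_mul_le _ _
    · rw [annealed_succ_of_ne h, annealed_succ_of_ne h, ← stepAvg_mul_left]
      exact stepAvg_mono fun a => (ih _ _).trans (by rw [add_assoc])

/-- Concatenate a path to `y` with a path from `y` to `z`. Starting the second piece with an empty
field only lowers the weight, because of `φ j * φ k ≤ φ (j + k)`. -/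
lemma annealed_mul_le [NeZero d] (hφ : IsLocalWeight φ) {z : Fin d → ℤ} (n m : ℕ) (x : Fin d → ℤ)
    (L : (Fin d → ℤ) →₀ ℕ) :
    annealed φ y n x L * annealed φ z m y 0 ≤ annealed φ z (n + m) x L := by
  have h1 : annealed φ z m y 0 ≤ 1 :=
    (hφ.annealed_le_fieldWeight m y 0).trans (hφ.fieldWeight_le_one 0)
  have h0 : 0 ≤ annealed φ z m y 0 := hφ.annealed_nonneg _ _ _
  induction n generalizing x L with
  | zero =>
    by_cases hy : x = y
    · subst hy
      rw [annealed_self, zero_add]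
      simpa using hφ.fieldWeight_mul_annealed_le m x L 0
    · rw [annealed_zero_of_ne hy, zero_mul]; exact hφ.annealed_nonneg _ _ _
  | succ n ih =>
    -- A path may meet `z` before `y`. The right side then stops with the full weight of the field,
    -- while the left side goes on and picks up factors that are at most one.
    by_cases hz : x = z
    · subst hz
      rw [annealed_self]
      exact (mul_le_of_le_one_right (hφ.annealed_nonneg _ _ _) h1).trans
        (hφ.annealed_le_fieldWeight _ _ _)
    by_cases hy : x = y
    · subst hy
      rw [annealed_self]
      refine le_trans ?_ (hφ.annealed_monotone x L (Nat.le_add_left m (n + 1)))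
      simpa using hφ.fieldWeight_mul_annealed_le m x L 0
    · rw [annealed_succ_of_ne hy, Nat.add_right_comm, annealed_succ_of_ne hz, ← stepAvg_mul_right]
      exact stepAvg_mono fun a => ih _ _

end IsLocalWeight

lemma fieldWeight_equivMapDomain (σ : (Fin d → ℤ) ≃ (Fin d → ℤ)) (L : (Fin d → ℤ) →₀ ℕ) :
    fieldWeight φ (Finsupp.equivMapDomain σ L) = fieldWeight φ L :=
  Finsupp.prod_equivMapDomain _ _ _

/-- The weight depends only on the multiset of local times, so lattice symmetries that permute the
steps preserve it. Used for translations and for `x ↦ -x`. -/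
lemma annealed_equiv (σ : (Fin d → ℤ) ≃ (Fin d → ℤ)) (e : (Fin d × Bool) ≃ (Fin d × Bool))
    (h : ∀ x a, σ (x + step a) = σ x + step (e a)) (n : ℕ) (x : Fin d → ℤ)
    (L : (Fin d → ℤ) →₀ ℕ) :
    annealed φ (σ y) n (σ x) (Finsupp.equivMapDomain σ L) = annealed φ y n x L := by
  induction n generalizing x L with
  | zero => simp [annealed, fieldWeight_equivMapDomain]
  | succ n ih =>
    by_cases hx : x = y
    · subst hx; rw [annealed_self, annealed_self, fieldWeight_equivMapDomain]
    · rw [annealed_succ_of_ne hx, annealed_succ_of_ne (σ.injective.ne hx), ← stepAvg_comp_equiv e]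
      congr 1
      ext a
      rw [← h, ← ih]
      congr 1
      ext z
      simp [Finsupp.equivMapDomain_apply, Finsupp.single_apply, Equiv.eq_symm_apply]

lemma annealed_translate (w : Fin d → ℤ) (n : ℕ) (x : Fin d → ℤ) :
    annealed φ (w + y) n (w + x) 0 = annealed φ y n x 0 := by
  simpa using annealed_equiv (φ := φ) (y := y) (Equiv.addLeft w) (Equiv.refl _)
    (fun x a => by simp [add_assoc]) n x 0

lemma step_not (a : Fin d × Bool) : step (a.1, !a.2) = -step a := by
  rcases a with ⟨i, b⟩
  cases b <;> simp [step, Pi.single_neg]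

lemma annealed_neg (n : ℕ) : annealed φ (-y) n 0 0 = annealed φ y n 0 0 := by
  simpa using annealed_equiv (φ := φ) (y := y) (Equiv.neg _)
    ((Equiv.refl _).prodCongr Equiv.boolNot)
    (fun x a => by
      rw [show ((Equiv.refl _).prodCongr Equiv.boolNot) a = (a.1, !a.2) from rfl, step_not]
      simp [add_comm]) n 0 0

/-! ### Crossing fresh slabs -/

/-- `Ψ r x C` majorizes the annealed weight picked up inside the slab `r ≤ X < r + R` until its
right end is passed, when the walk is at `x` and has left the local times `C` in the slab. -/
structure IsSlabMajorant (φ : ℕ → ℝ) (X : (Fin d → ℤ) →+ ℝ) (R ρ : ℝ)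
    (Ψ : ℝ → (Fin d → ℤ) → ((Fin d → ℤ) →₀ ℕ) → ℝ) : Prop where
  nonneg : ∀ r x C, (∀ z ∈ C.support, r ≤ X z ∧ X z < r + R) → X x < r + R → 0 ≤ Ψ r x C
  inside : ∀ r x C, (∀ z ∈ C.support, r ≤ X z ∧ X z < r + R) → r ≤ X x → X x < r + R →
    stepAvg (fun a => Ψ r (x + step a) (C + Finsupp.single x 1)) ≤ Ψ r x C
  -- Behind the slab `C` does not grow: time spent there is not charged.
  below : ∀ r x C, (∀ z ∈ C.support, r ≤ X z ∧ X z < r + R) → X x < r →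
    stepAvg (fun a => Ψ r (x + step a) C) ≤ Ψ r x C
  exit : ∀ r x C, (∀ z ∈ C.support, r ≤ X z ∧ X z < r + R) → r + R ≤ X x → X x < r + R + 1 →
    fieldWeight φ C ≤ Ψ r x C
  start : ∀ r x, r ≤ X x → X x < r + 1 → Ψ r x 0 ≤ ρ

lemma disjoint_support_of_slab {X : (Fin d → ℤ) →+ ℝ} {r : ℝ} {B C : (Fin d → ℤ) →₀ ℕ}
    (hB : ∀ z ∈ B.support, X z < r) (hC : ∀ z ∈ C.support, r ≤ X z) :
    Disjoint B.support C.support :=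
  Finset.disjoint_left.2 fun z h1 h2 => absurd (hB z h1) (not_lt.2 (hC z h2))

lemma forall_mem_support_add_single {p : (Fin d → ℤ) → Prop} {C : (Fin d → ℤ) →₀ ℕ}
    {x : Fin d → ℤ} (hC : ∀ z ∈ C.support, p z) (hx : p x) :
    ∀ z ∈ (C + Finsupp.single x 1).support, p z := by
  classical
  intro z hz
  rcases Finset.mem_union.1 (Finsupp.support_add hz) with h | h
  · exact hC z h
  · rw [Finset.mem_singleton.1 (Finsupp.support_single_subset h)]; exact hx

/-- `B` holds the local times behind the current slab, `C` those inside it, and `j` counts the slabs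
still to be crossed afterwards. The supports of `B` and `C` are disjoint, so their weights multiply;
along the walk the right side is a supermartingale that dominates the weight. -/
lemma IsSlabMajorant.annealed_le_mul [NeZero d] {X : (Fin d → ℤ) →+ ℝ} {R ρ : ℝ}
    {Ψ : ℝ → (Fin d → ℤ) → ((Fin d → ℤ) →₀ ℕ) → ℝ} (hΨ : IsSlabMajorant φ X R ρ Ψ)
    (hφ : IsLocalWeight φ) (hX : ∀ a, X (step a) ≤ 1) (hR : 1 ≤ R) (hρ : 0 ≤ ρ) (n j : ℕ)
    (r : ℝ) (x : Fin d → ℤ) (B C : (Fin d → ℤ) →₀ ℕ)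
    (hB : ∀ z ∈ B.support, X z < r) (hC : ∀ z ∈ C.support, r ≤ X z ∧ X z < r + R)
    (hx : X x < r + R) (hy : r + (j + 1) * R ≤ X y) :
    annealed φ y n x (B + C) ≤ fieldWeight φ B * Ψ r x C * ρ ^ j := by
  have hjR : 0 ≤ (j : ℝ) * R := mul_nonneg (Nat.cast_nonneg j) (by linarith)
  have hxy : x ≠ y := by rintro rfl; nlinarith
  have hB0 := (hφ.fieldWeight_pos B).le
  induction n generalizing j r x B C with
  | zero =>
    rw [annealed_zero_of_ne hxy]
    exact mul_nonneg (mul_nonneg hB0 (hΨ.nonneg r x C hC hx)) (pow_nonneg hρ j)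
  | succ n ih =>
    rw [annealed_succ_of_ne hxy]
    rcases lt_or_ge (X x) r with hr | hr
    · refine le_trans ?_ (mul_le_mul_of_nonneg_right
        (mul_le_mul_of_nonneg_left (hΨ.below r x C hC hr) hB0) (pow_nonneg hρ j))
      rw [← stepAvg_mul_left, ← stepAvg_mul_right]
      refine stepAvg_mono fun a => ?_
      have hxa : X (x + step a) < r + R := by rw [map_add]; linarith [hX a]
      -- A visit behind the slab is charged to `B`, and its factor is then dropped by monotonicity.
      rw [show B + C + Finsupp.single x 1 = (B + Finsupp.single x 1) + C by abel]
      refine (ih j r (x + step a) _ C (forall_mem_support_add_single hB hr) hC hxa hy hjR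
        (by rintro rfl; nlinarith) (hφ.fieldWeight_pos _).le).trans ?_
      have : fieldWeight φ (B + Finsupp.single x 1) ≤ fieldWeight φ B :=
        hφ.fieldWeight_anti (le_add_of_nonneg_right zero_le)
      exact mul_le_mul_of_nonneg_right (mul_le_mul_of_nonneg_right this
        (hΨ.nonneg _ _ _ hC hxa)) (pow_nonneg hρ j)
    · refine le_trans ?_ (mul_le_mul_of_nonneg_right
        (mul_le_mul_of_nonneg_left (hΨ.inside r x C hC hr hx) hB0) (pow_nonneg hρ j))
      rw [← stepAvg_mul_left, ← stepAvg_mul_right]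
      refine stepAvg_mono fun a => ?_
      have hC' := forall_mem_support_add_single (x := x) hC ⟨hr, hx⟩
      have hxa1 : X (x + step a) < r + R + 1 := by rw [map_add]; linarith [hX a]
      rw [add_assoc B C]
      rcases lt_or_ge (X (x + step a)) (r + R) with hxa | hxa
      · exact ih j r (x + step a) B _ hB hC' hxa hy hjR (by rintro rfl; nlinarith) hB0
      · have hsplit := fieldWeight_add_of_disjoint φ
          (disjoint_support_of_slab hB fun z hz => (hC' z hz).1)
        have hexit := hΨ.exit r (x + step a) _ hC' hxa hxa1
        cases j with
        | zero =>
          refine (hφ.annealed_le_fieldWeight _ _ _).trans ?_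
          rw [hsplit, pow_zero, mul_one]
          exact mul_le_mul_of_nonneg_left hexit hB0
        | succ j =>
          push_cast at hy
          have hj : 0 ≤ (j : ℝ) * R := mul_nonneg (Nat.cast_nonneg j) (by linarith)
          have hB' : ∀ z ∈ (B + (C + Finsupp.single x 1)).support, X z < r + R := by
            classical
            intro z hz
            rcases Finset.mem_union.1 (Finsupp.support_add hz) with h | h
            · linarith [hB z h]
            · exact (hC' z h).2
          have := ih j (r + R) (x + step a) (B + (C + Finsupp.single x 1)) 0 hB'
            (by simp) (by linarith) (by linarith) hj
            (by intro h; rw [← h] at hy; nlinarith) (hφ.fieldWeight_pos _).le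
          rw [add_zero] at this
          refine this.trans ?_
          rw [hsplit, pow_succ' ρ j, ← mul_assoc]
          refine mul_le_mul_of_nonneg_right ?_ (pow_nonneg hρ j)
          exact mul_le_mul (mul_le_mul_of_nonneg_left hexit hB0)
            (hΨ.start _ _ hxa (by linarith))
            (hΨ.nonneg _ _ _ (by simp) (by linarith))
            (mul_nonneg hB0 ((hφ.fieldWeight_pos _).le.trans hexit))

lemma IsSlabMajorant.annealed_le_pow [NeZero d] {X : (Fin d → ℤ) →+ ℝ} {R ρ : ℝ}
    {Ψ : ℝ → (Fin d → ℤ) → ((Fin d → ℤ) →₀ ℕ) → ℝ} (hΨ : IsSlabMajorant φ X R ρ Ψ)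
    (hφ : IsLocalWeight φ) (hX : ∀ a, X (step a) ≤ 1) (hR : 1 ≤ R) (n j : ℕ)
    (hy : j * R ≤ X y) : annealed φ y n 0 0 ≤ ρ ^ j := by
  have h0 : 0 ≤ Ψ 0 0 0 := hΨ.nonneg 0 0 0 (by simp) (by simp; linarith)
  have h1 : Ψ 0 0 0 ≤ ρ := hΨ.start 0 0 (by simp) (by simp)
  cases j with
  | zero =>
    rw [pow_zero]
    exact (hφ.annealed_le_fieldWeight _ _ _).trans (hφ.fieldWeight_le_one _)
  | succ j =>
    push_cast at hy
    have := hΨ.annealed_le_mul hφ hX hR (h0.trans h1) n j 0 0 0 0 (by simp) (by simp)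
      (by simp; linarith) (by simpa using hy)
    rw [add_zero, fieldWeight_zero, one_mul] at this
    refine this.trans ?_
    rw [pow_succ']
    exact mul_le_mul_of_nonneg_right h1 (pow_nonneg (h0.trans h1) j)

/-- Every unit slab contains a visited site. -/
lemma isSlabMajorant_visited [NeZero d] (hφ : IsLocalWeight φ) {X : (Fin d → ℤ) →+ ℝ}
    (hX : ∀ a, X (step a) ≤ 1) :
    IsSlabMajorant φ X 1 (φ 1)
      (open Classical in fun r x C => if C ≠ 0 ∨ X x < r + 1 then φ 1 else 1) where
  nonneg r x C _ _ := by split_ifs; exacts [(hφ.pos 1).le, zero_le_one]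
  inside r x C _ _ hx := by
    rw [if_pos (Or.inr hx)]
    refine le_of_eq ?_
    have : C + Finsupp.single x 1 ≠ 0 := by
      intro h
      simpa using DFunLike.congr_fun h x
    simp [this]
  below r x C _ hx := by
    rw [if_pos (Or.inr (by linarith))]
    refine le_of_eq ?_
    have : ∀ a, X (x + step a) < r + 1 := fun a => by rw [map_add]; linarith [hX a]
    simp only [this, or_true, if_true, stepAvg_const]
  exit r x C _ hx _ := by
    by_cases h : C = 0
    · simp [h, not_lt.2 hx]
    · rw [if_pos (Or.inl h)]
      obtain ⟨z, hz⟩ := Finsupp.ne_iff.1 h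
      have : Finsupp.single z 1 ≤ C := by
        rw [Finsupp.single_le_iff]
        exact Nat.one_le_iff_ne_zero.2 hz
      refine (hφ.fieldWeight_anti this).trans ?_
      simp [fieldWeight, Finsupp.prod_single_index, hφ.zero]
  start r x _ hx := by rw [if_pos (Or.inr hx)]

/-! ### Slabs orthogonal to a unit vector -/

lemma stepAvg_odd (X : (Fin d → ℤ) →+ ℝ) {f : ℝ → ℝ} (hf : ∀ t, f (-t) = -f t) :
    stepAvg (fun a => f (X (step a))) = 0 := by
  have h := stepAvg_comp_equiv ((Equiv.refl (Fin d)).prodCongr Equiv.boolNot)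
    (fun a => f (X (step a)))
  have h2 : (fun a : Fin d × Bool =>
      f (X (step (((Equiv.refl (Fin d)).prodCongr Equiv.boolNot) a))))
      = fun a => (-1) * f (X (step a)) := by
    ext a
    rw [show ((Equiv.refl _).prodCongr Equiv.boolNot) a = (a.1, !a.2) from rfl, step_not,
      map_neg, hf, neg_one_mul]
  rw [h2, stepAvg_mul_left] at h
  linarith

lemma stepAvg_map_step (X : (Fin d → ℤ) →+ ℝ) : stepAvg (fun a => X (step a)) = 0 :=
  stepAvg_odd X (f := id) fun _ => rfl

/-- Since `max (t + u) 0 ≤ |max t 0 + u|`, the addition formula for `cosh` applies; its `sinh` term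
is odd in the step and averages to zero. -/
lemma stepAvg_cosh_le [NeZero d] {X : (Fin d → ℤ) →+ ℝ} {a c : ℝ}
    (hc : stepAvg (fun s => Real.cosh (a * X (step s))) ≤ Real.exp c) (t : ℝ) :
    stepAvg (fun s => Real.cosh (a * max (t + X (step s)) 0)) ≤
      Real.exp c * Real.cosh (a * max t 0) := by
  have hle : ∀ s : Fin d × Bool, Real.cosh (a * max (t + X (step s)) 0) ≤
      Real.cosh (a * max t 0) * Real.cosh (a * X (step s)) +
        Real.sinh (a * max t 0) * Real.sinh (a * X (step s)) := by
    intro s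
    rw [← Real.cosh_add, ← mul_add, Real.cosh_le_cosh, abs_mul, abs_mul]
    refine mul_le_mul_of_nonneg_left ?_ (abs_nonneg a)
    rw [abs_of_nonneg (le_max_right _ _)]
    refine max_le ?_ (abs_nonneg _)
    exact (add_le_add_left (le_max_left t 0) _).trans (le_abs_self _)
  refine (stepAvg_mono hle).trans ?_
  rw [stepAvg_add, stepAvg_mul_left, stepAvg_mul_left,
    stepAvg_odd X (f := fun t => Real.sinh (a * t)) (fun t => by simp), mul_zero, add_zero,
    mul_comm]
  exact mul_le_mul_of_nonneg_right hc (Real.cosh_pos _).le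

lemma le_stepAvg_max [NeZero d] (X : (Fin d → ℤ) →+ ℝ) (u t : ℝ) :
    max u t ≤ stepAvg (fun s => max u (t + X (step s))) := by
  refine max_le ?_ ?_
  · exact (stepAvg_const (d := d) u).ge.trans (stepAvg_mono fun s => le_max_left _ _)
  · refine le_trans ?_ (stepAvg_mono fun s => le_max_right _ _)
    rw [stepAvg_add, stepAvg_const, stepAvg_map_step X, add_zero]

/-- The kink of `u ↦ max t u` at `t` produces a strict drift. This gain pays for returns to visited
sites. -/
lemma le_stepAvg_max_self [NeZero d] {X : (Fin d → ℤ) →+ ℝ} (hX : ∀ a, |X (step a)| ≤ 1)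
    (hX2 : stepAvg (fun a => X (step a) ^ 2) = 1 / d) (t : ℝ) :
    t + 1 / (2 * d) ≤ stepAvg (fun s => max t (t + X (step s))) := by
  -- For `|u| ≤ 1` the positive part of `u` is at least `(u + u²) / 2`.
  have hle : ∀ s : Fin d × Bool,
      t + (1 / 2) * (X (step s) + X (step s) ^ 2) ≤ max t (t + X (step s)) := by
    intro s
    have h := abs_le.1 (hX s)
    rcases le_total 0 (X (step s)) with h0 | h0
    · exact le_max_of_le_right (by nlinarith)
    · exact le_max_of_le_left (by nlinarith)
  refine le_trans (le_of_eq ?_) (stepAvg_mono hle)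
  rw [stepAvg_add, stepAvg_const, stepAvg_mul_left, stepAvg_add, hX2,
    stepAvg_map_step X]
  ring

/-- Convexity: `u ↦ max u 0 ^ 2` lies above its tangent at `t`, whose slope term averages to zero.
-/
lemma le_stepAvg_sq_max [NeZero d] {X : (Fin d → ℤ) →+ ℝ} (t : ℝ) :
    max t 0 ^ 2 ≤ stepAvg (fun s => max (t + X (step s)) 0 ^ 2) := by
  have hle : ∀ s : Fin d × Bool,
      max t 0 ^ 2 + 2 * max t 0 * X (step s) ≤ max (t + X (step s)) 0 ^ 2 := by
    intro s
    rcases le_total 0 t with h0 | h0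
    · rw [max_eq_left h0]
      rcases le_total 0 (t + X (step s)) with h1 | h1
      · rw [max_eq_left h1]; nlinarith [sq_nonneg (X (step s))]
      · rw [max_eq_right h1]; nlinarith
    · rw [max_eq_right h0]; simp
  refine le_trans (le_of_eq ?_) (stepAvg_mono hle)
  rw [stepAvg_add, stepAvg_const, stepAvg_mul_left, stepAvg_map_step X]
  ring

lemma stepAvg_sq_max [NeZero d] {X : (Fin d → ℤ) →+ ℝ} (hX : ∀ a, |X (step a)| ≤ 1)
    (hX2 : stepAvg (fun a => X (step a) ^ 2) = 1 / d) {t : ℝ} (ht : 1 ≤ t) :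
    stepAvg (fun s => max (t + X (step s)) 0 ^ 2) = max t 0 ^ 2 + 1 / d := by
  have heq : (fun s : Fin d × Bool => max (t + X (step s)) 0 ^ 2) =
      fun s => t ^ 2 + (2 * t * X (step s) + X (step s) ^ 2) := by
    ext s
    rw [max_eq_left (by linarith [(abs_le.1 (hX s)).1])]
    ring
  rw [heq, stepAvg_add, stepAvg_add, stepAvg_const, stepAvg_mul_left, hX2,
    stepAvg_map_step X, max_eq_left (by linarith)]
  ring

/-! ### Self-intersections of the walk in a slab -/

/-- The total local time. -/
def totalTime (C : (Fin d → ℤ) →₀ ℕ) : ℝ := C.sum fun _ k => (k : ℝ)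

/-- The sum of the squared local times. -/
def selfIntersection (C : (Fin d → ℤ) →₀ ℕ) : ℝ := C.sum fun _ k => (k : ℝ) ^ 2

/-- The majorant of the future growth of `selfIntersection` caused by returns to old sites. -/
def returnPotential (X : (Fin d → ℤ) →+ ℝ) (b : ℝ) (x : Fin d → ℤ) (C : (Fin d → ℤ) →₀ ℕ) : ℝ :=
  C.sum fun z k => (k : ℝ) * (b - max (X z) (X x))

lemma totalTime_add_single (C : (Fin d → ℤ) →₀ ℕ) (x : Fin d → ℤ) :
    totalTime (C + Finsupp.single x 1) = totalTime C + 1 := by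
  classical
  rw [totalTime, Finsupp.sum_add_index' (by simp) (by intros; push_cast; ring)]
  simp [totalTime]

lemma returnPotential_add_single (X : (Fin d → ℤ) →+ ℝ) (b : ℝ) (w x : Fin d → ℤ)
    (C : (Fin d → ℤ) →₀ ℕ) :
    returnPotential X b w (C + Finsupp.single x 1) =
      returnPotential X b w C + (b - max (X x) (X w)) := by
  classical
  rw [returnPotential, Finsupp.sum_add_index' (by simp) (by intros; push_cast; ring)]
  simp [returnPotential]

lemma selfIntersection_add_single (C : (Fin d → ℤ) →₀ ℕ) (x : Fin d → ℤ) :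
    selfIntersection (C + Finsupp.single x 1) = selfIntersection C + 2 * C x + 1 := by
  classical
  have hs : C.support ⊆ insert x C.support := Finset.subset_insert _ _
  have hs' : (C + Finsupp.single x 1).support ⊆ insert x C.support := fun z hz =>
    forall_mem_support_add_single (p := fun z => z ∈ insert x C.support) (fun w hw => hs hw)
      (Finset.mem_insert_self _ _) z hz
  rw [selfIntersection, selfIntersection, Finsupp.sum_of_support_subset _ hs' _ (by simp),
    Finsupp.sum_of_support_subset _ hs _ (by simp)]
  have : ∀ z ∈ insert x C.support, (((C + Finsupp.single x 1 : (Fin d → ℤ) →₀ ℕ) z : ℕ) : ℝ) ^ 2 =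
      (C z : ℝ) ^ 2 + if z = x then 2 * (C x : ℝ) + 1 else 0 := by
    intro z _
    by_cases h : z = x
    · subst h; simp; ring
    · simp [h]
  rw [Finset.sum_congr rfl this, Finset.sum_add_distrib, Finset.sum_ite_eq',
    if_pos (Finset.mem_insert_self _ _)]
  ring

lemma selfIntersection_nonneg (C : (Fin d → ℤ) →₀ ℕ) : 0 ≤ selfIntersection C :=
  Finset.sum_nonneg fun _ _ => sq_nonneg _

lemma returnPotential_nonneg {X : (Fin d → ℤ) →+ ℝ} {b : ℝ} {x : Fin d → ℤ}
    {C : (Fin d → ℤ) →₀ ℕ} (hx : X x ≤ b) (hC : ∀ z ∈ C.support, X z ≤ b) :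
    0 ≤ returnPotential X b x C :=
  Finset.sum_nonneg fun z hz =>
    mul_nonneg (Nat.cast_nonneg _) (sub_nonneg.2 (max_le (hC z hz) hx))

lemma stepAvg_returnPotential_le [NeZero d] {X : (Fin d → ℤ) →+ ℝ} {b : ℝ} {x : Fin d → ℤ}
    {C : (Fin d → ℤ) →₀ ℕ} :
    stepAvg (fun a => returnPotential X b (x + step a) C) ≤ returnPotential X b x C := by
  simp only [returnPotential, Finsupp.sum]
  rw [stepAvg_sum]
  refine Finset.sum_le_sum fun z _ => ?_
  rw [stepAvg_mul_left]
  refine mul_le_mul_of_nonneg_left ?_ (Nat.cast_nonneg _)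
  have := le_stepAvg_max X (X z) (X x)
  have h2 : (fun a : Fin d × Bool => b - max (X z) (X (x + step a))) =
      fun a => b + (-1) * max (X z) (X x + X (step a)) := by
    ext a; rw [map_add]; ring
  rw [h2, stepAvg_add, stepAvg_const, stepAvg_mul_left]
  linarith

/-- All terms are supermartingales by convexity of `max`; the term of the present site `x` sits at
its kink and gains `1 / (2 * d)` per unit of local time. -/
lemma stepAvg_returnPotential_le_sub [NeZero d] {X : (Fin d → ℤ) →+ ℝ}
    (hX : ∀ a, |X (step a)| ≤ 1)
    (hX2 : stepAvg (fun a => X (step a) ^ 2) = 1 / d) {b : ℝ} {x : Fin d → ℤ}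
    {C : (Fin d → ℤ) →₀ ℕ} :
    stepAvg (fun a => returnPotential X b (x + step a) C) ≤
      returnPotential X b x C - C x / (2 * d) := by
  classical
  have hsum : (C x : ℝ) / (2 * d) =
      ∑ z ∈ insert x C.support, if z = x then (C x : ℝ) / (2 * d) else 0 := by
    rw [Finset.sum_ite_eq', if_pos (Finset.mem_insert_self _ _)]
  have hs : C.support ⊆ insert x C.support := Finset.subset_insert _ _
  have hexp : ∀ w, returnPotential X b w C =
      ∑ z ∈ insert x C.support, (C z : ℝ) * (b - max (X z) (X w)) := fun w =>
    Finsupp.sum_of_support_subset C hs _ (by simp)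
  simp only [hexp]
  rw [stepAvg_sum, hsum, ← Finset.sum_sub_distrib]
  refine Finset.sum_le_sum fun z _ => ?_
  rw [stepAvg_mul_left]
  have h2 : (fun a : Fin d × Bool => b - max (X z) (X (x + step a))) =
      fun a => b + (-1) * max (X z) (X x + X (step a)) := by
    ext a; rw [map_add]; ring
  rw [h2, stepAvg_add, stepAvg_const, stepAvg_mul_left]
  by_cases h : z = x
  · subst h
    have := mul_le_mul_of_nonneg_left (le_stepAvg_max_self hX hX2 (X z))
      (Nat.cast_nonneg (α := ℝ) (C z))
    rw [if_pos rfl, max_self]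
    have e : (C z : ℝ) / (2 * d) = C z * (1 / (2 * d)) := by ring
    rw [e]
    linarith
  · rw [if_neg h, sub_zero]
    refine mul_le_mul_of_nonneg_left ?_ (Nat.cast_nonneg _)
    linarith [le_stepAvg_max X (X z) (X x)]

/-- A majorant of the expected final value of `selfIntersection` in the slab `r ≤ X < r + R`. -/
def intersectionMajorant (X : (Fin d → ℤ) →+ ℝ) (R r : ℝ) (x : Fin d → ℤ)
    (C : (Fin d → ℤ) →₀ ℕ) : ℝ :=
  -- A visit to `x` raises `selfIntersection` by `2 * C x + 1`. The factor `4 * d` turns the drift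
  -- `C x / (2 * d)` of `returnPotential` into `2 * C x`. The new unit of local time adds at most `4
  -- * d * (R + 1)` to the second term; this and the `1` are paid by the quadratic term, since the
  -- square of the height gains `1 / d` per step in the slab. The shift by `1` keeps the square
  -- untruncated during such a step.
  selfIntersection C + 4 * d * returnPotential X (r + R + 1) x C +
    d * (1 + 4 * d * (R + 1)) * ((R + 2) ^ 2 - max (X x - r + 1) 0 ^ 2)

section

variable {X : (Fin d → ℤ) →+ ℝ} {R r : ℝ} {x : Fin d → ℤ} {C : (Fin d → ℤ) →₀ ℕ}

lemma selfIntersection_le_intersectionMajorant (hR : 1 ≤ R)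
    (hC : ∀ z ∈ C.support, r ≤ X z ∧ X z < r + R) (hx : X x < r + R + 1) :
    selfIntersection C ≤ intersectionMajorant X R r x C := by
  have h1 : 0 ≤ returnPotential X (r + R + 1) x C :=
    returnPotential_nonneg hx.le fun z hz => by linarith [(hC z hz).2]
  have h2 : max (X x - r + 1) 0 ^ 2 ≤ (R + 2) ^ 2 := by
    refine pow_le_pow_left₀ (le_max_right _ _) (max_le ?_ ?_) 2 <;> linarith
  have h3 : 0 ≤ (d : ℝ) * (1 + 4 * d * (R + 1)) := by positivity
  have h4 := mul_nonneg h3 (sub_nonneg.2 h2)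
  have h5 : 0 ≤ 4 * (d : ℝ) * returnPotential X (r + R + 1) x C := by positivity
  unfold intersectionMajorant
  linarith

lemma stepAvg_sub_sq_max (X : (Fin d → ℤ) →+ ℝ) (R r : ℝ) (x : Fin d → ℤ) [NeZero d] :
    stepAvg (fun a => (R + 2) ^ 2 - max (X (x + step a) - r + 1) 0 ^ 2) =
      (R + 2) ^ 2 - stepAvg (fun a => max ((X x - r + 1) + X (step a)) 0 ^ 2) := by
  have : (fun a : Fin d × Bool => (R + 2) ^ 2 - max (X (x + step a) - r + 1) 0 ^ 2) =
      fun a => (R + 2) ^ 2 + (-1) * max ((X x - r + 1) + X (step a)) 0 ^ 2 := by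
    ext a
    rw [map_add, show X x + X (step a) - r + 1 = (X x - r + 1) + X (step a) by ring]
    ring
  rw [this, stepAvg_add, stepAvg_const, stepAvg_mul_left]
  ring

lemma stepAvg_intersectionMajorant_below [NeZero d] (hR : 1 ≤ R) :
    stepAvg (fun a => intersectionMajorant X R r (x + step a) C) ≤
      intersectionMajorant X R r x C := by
  simp only [intersectionMajorant]
  rw [stepAvg_add, stepAvg_add, stepAvg_const, stepAvg_mul_left, stepAvg_mul_left,
    stepAvg_sub_sq_max]
  have h3 : 0 ≤ (d : ℝ) * (1 + 4 * d * (R + 1)) := by positivity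
  have h4 := mul_le_mul_of_nonneg_left (le_stepAvg_sq_max (X := X) (X x - r + 1)) h3
  have h5 := mul_le_mul_of_nonneg_left
    (stepAvg_returnPotential_le (X := X) (b := r + R + 1) (x := x) (C := C))
    (show 0 ≤ 4 * (d : ℝ) by positivity)
  linarith

lemma stepAvg_intersectionMajorant_inside [NeZero d] (hR : 1 ≤ R)
    (hX : ∀ a, |X (step a)| ≤ 1) (hX2 : stepAvg (fun a => X (step a) ^ 2) = 1 / d)
    (hx : r ≤ X x) :
    stepAvg (fun a => intersectionMajorant X R r (x + step a) (C + Finsupp.single x 1)) ≤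
      intersectionMajorant X R r x C := by
  have hd : (0 : ℝ) < d := Nat.cast_pos.2 (Nat.pos_of_ne_zero (NeZero.ne d))
  simp only [intersectionMajorant, returnPotential_add_single, selfIntersection_add_single]
  rw [stepAvg_add, stepAvg_add, stepAvg_const, stepAvg_mul_left, stepAvg_mul_left,
    stepAvg_sub_sq_max, stepAvg_add, stepAvg_sq_max hX hX2 (by linarith)]
  have h1 : stepAvg (fun a => r + R + 1 - max (X x) (X (x + step a))) ≤ R + 1 := by
    refine (stepAvg_mono fun a => ?_).trans (stepAvg_const (R + 1)).le
    linarith [le_max_left (X x) (X (x + step a))]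
  have h2 := stepAvg_returnPotential_le_sub hX hX2 (b := r + R + 1) (x := x) (C := C)
  have h3 := mul_le_mul_of_nonneg_left (add_le_add h2 h1) (show 0 ≤ 4 * (d : ℝ) by positivity)
  have h4 : 4 * (d : ℝ) * (C x / (2 * d)) = 2 * C x := by field_simp; ring
  have h5 : (d : ℝ) * (1 + 4 * d * (R + 1)) * (1 / d) = 1 + 4 * d * (R + 1) := by field_simp
  linarith

end

lemma fieldWeight_le_exp (hφ : IsLocalWeight φ) {c η : ℝ}
    (h : ∀ k : ℕ, φ k ≤ Real.exp (-c * k + η * (k : ℝ) ^ 2)) (C : (Fin d → ℤ) →₀ ℕ) :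
    fieldWeight φ C ≤ Real.exp (-c * totalTime C + η * selfIntersection C) := by
  simp only [fieldWeight, totalTime, selfIntersection, Finsupp.prod, Finsupp.sum]
  rw [Finset.mul_sum, Finset.mul_sum, ← Finset.sum_add_distrib, Real.exp_sum]
  exact Finset.prod_le_prod (fun _ _ => (hφ.pos _).le) fun z _ => h _

/-- The majorant for the slabs orthogonal to a unit vector. -/
def slabMajorant (X : (Fin d → ℤ) →+ ℝ) (R a c η r : ℝ) (x : Fin d → ℤ)
    (C : (Fin d → ℤ) →₀ ℕ) : ℝ :=
  -- The first summand handles fields with `η * selfIntersection ≤ 1`, the second all others. The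
  -- `cosh` factor is flat for `X x ≤ r + 1`, hence constant during a step taken behind the slab;
  -- this costs one unit of width.
  Real.exp 1 / Real.cosh (a * (R - 1)) * Real.exp (-c * totalTime C) *
    Real.cosh (a * max (X x - r - 1) 0) + η * intersectionMajorant X R r x C

lemma isSlabMajorant_slabMajorant [NeZero d] (hφ : IsLocalWeight φ) {X : (Fin d → ℤ) →+ ℝ}
    (hX : ∀ a, |X (step a)| ≤ 1) (hX2 : stepAvg (fun a => X (step a) ^ 2) = 1 / d)
    {R a c η : ℝ} (hR : 1 ≤ R) (hη : 0 ≤ η)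
    (hφc : ∀ k : ℕ, φ k ≤ Real.exp (-c * k + η * (k : ℝ) ^ 2))
    (hac : stepAvg (fun s => Real.cosh (a * X (step s))) ≤ Real.exp c) :
    IsSlabMajorant φ X R
      (Real.exp 1 / Real.cosh (a * (R - 1)) + η * (d * (1 + 4 * d * (R + 1)) * (R + 2) ^ 2))
      (slabMajorant X R a c η) where
  nonneg r x C hC hx := by
    have := (selfIntersection_nonneg C).trans
      (selfIntersection_le_intersectionMajorant hR hC (by linarith : X x < r + R + 1))
    have h1 := Real.cosh_pos (a * (R - 1))
    have h2 := Real.cosh_pos (a * max (X x - r - 1) 0)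
    unfold slabMajorant
    positivity
  inside r x C hC hr hx := by
    simp only [slabMajorant, totalTime_add_single]
    rw [stepAvg_add, stepAvg_mul_left, stepAvg_mul_left]
    refine add_le_add ?_ (mul_le_mul_of_nonneg_left
      (stepAvg_intersectionMajorant_inside hR hX hX2 hr) hη)
    have h := stepAvg_cosh_le hac (X x - r - 1)
    have e : ∀ s : Fin d × Bool, X (x + step s) - r - 1 = X x - r - 1 + X (step s) := by
      intro s; rw [map_add]; ring
    simp only [e]
    refine (mul_le_mul_of_nonneg_left h ?_).trans (le_of_eq ?_)
    · have := Real.cosh_pos (a * (R - 1)); positivity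
    · rw [show -c * (totalTime C + 1) = -c * totalTime C + -c by ring, Real.exp_add]
      have : Real.exp (-c) * Real.exp c = 1 := by rw [← Real.exp_add]; simp
      calc _ = Real.exp 1 / Real.cosh (a * (R - 1)) * Real.exp (-c * totalTime C) *
            Real.cosh (a * max (X x - r - 1) 0) * (Real.exp (-c) * Real.exp c) := by ring
        _ = _ := by rw [this, mul_one]
  below r x C hC hx := by
    simp only [slabMajorant]
    rw [stepAvg_add, stepAvg_mul_left, stepAvg_mul_left]
    refine add_le_add ?_ (mul_le_mul_of_nonneg_left
      (stepAvg_intersectionMajorant_below hR) hη)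
    have e : ∀ s : Fin d × Bool, max (X (x + step s) - r - 1) 0 = 0 := by
      intro s; rw [map_add]
      exact max_eq_right (by linarith [(abs_le.1 (hX s)).2])
    simp only [e, stepAvg_const]
    rw [max_eq_right (by linarith : X x - r - 1 ≤ 0)]
  exit r x C hC hr hx := by
    have h1 := Real.cosh_pos (a * (R - 1))
    have h2 := Real.cosh_pos (a * max (X x - r - 1) 0)
    have hQ := mul_le_mul_of_nonneg_left (selfIntersection_le_intersectionMajorant hR hC hx) hη
    have hQ0 := mul_nonneg hη (selfIntersection_nonneg C)
    unfold slabMajorant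
    -- With few self-intersections the quadratic correction is at most a factor `e`. Otherwise the
    -- trivial bound `1` on the weight is below `η * selfIntersection C`.
    rcases le_total (η * selfIntersection C) 1 with h | h
    · refine (fieldWeight_le_exp hφ hφc C).trans ?_
      refine le_trans ?_ (le_add_of_nonneg_right (hQ0.trans hQ))
      have h3 : Real.cosh (a * (R - 1)) ≤ Real.cosh (a * max (X x - r - 1) 0) := by
        rw [Real.cosh_le_cosh, abs_mul, abs_mul]
        refine mul_le_mul_of_nonneg_left ?_ (abs_nonneg a)
        rw [abs_of_nonneg (by linarith : 0 ≤ R - 1), abs_of_nonneg (le_max_right _ _)]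
        exact le_max_of_le_left (by linarith)
      have h4 : Real.exp (-c * totalTime C + η * selfIntersection C) ≤
          Real.exp 1 * Real.exp (-c * totalTime C) := by
        rw [← Real.exp_add]; exact Real.exp_le_exp.2 (by linarith)
      refine h4.trans ?_
      rw [div_mul_eq_mul_div, div_mul_eq_mul_div, le_div_iff₀ h1]
      exact mul_le_mul_of_nonneg_left h3 (by positivity)
    · refine (hφ.fieldWeight_le_one C).trans (h.trans (hQ.trans ?_))
      exact le_add_of_nonneg_left (by positivity)
  start r x hr hx := by
    unfold slabMajorant intersectionMajorant
    have h3 : 0 ≤ (d : ℝ) * (1 + 4 * d * (R + 1)) := by positivity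
    have h0 : max (X x - r - 1) 0 = 0 := max_eq_right (by linarith)
    simp only [h0, totalTime, selfIntersection, returnPotential, Finsupp.sum_zero_index, mul_zero,
      Real.exp_zero, Real.cosh_zero, mul_one, zero_add]
    refine add_le_add_right (mul_le_mul_of_nonneg_left (mul_le_mul_of_nonneg_left ?_ h3) hη) _
    linarith [sq_nonneg (max (X x - r + 1) 0)]

/-! ### The Markov property at time one -/

/-- The sequence of steps `a, s 0, s 1, …`. -/
def consStep (p : (Fin d × Bool) × (ℕ → Fin d × Bool)) : ℕ → Fin d × Bool
  | 0 => p.1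
  | n + 1 => p.2 n

lemma measurable_consStep : Measurable (consStep (d := d)) := by
  refine measurable_pi_lambda _ fun n => ?_
  cases n with
  | zero => exact measurable_fst
  | succ n => exact (measurable_pi_apply n).comp measurable_snd

instance [NeZero d] : IsProbabilityMeasure (walkMeasure d) := by
  unfold walkMeasure; infer_instance

/-- An independent uniform step prepended to the walk gives the walk again. It suffices to compare
the two measures on finite-dimensional boxes. -/
lemma map_consStep [NeZero d] :
    ((PMF.uniformOfFintype (Fin d × Bool)).toMeasure.prod (walkMeasure d)).map consStep =
      walkMeasure d := by
  classical
  refine Measure.eq_infinitePi _ fun s t ht => ?_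
  set μ := (PMF.uniformOfFintype (Fin d × Bool)).toMeasure
  set t' : ℕ → Set (Fin d × Bool) := fun i => if i ∈ s then t i else Set.univ with ht'
  have hmt' : ∀ i, MeasurableSet (t' i) := fun i => .of_discrete
  -- Enlarging the coordinate set to an initial segment lets the first coordinate split off cleanly.
  obtain ⟨N, hN⟩ : ∃ N, s ⊆ Finset.range (N + 1) :=
    ⟨s.sup id, fun i hi => Finset.mem_range.2 (Nat.lt_succ_of_le (Finset.le_sup (f := id) hi))⟩
  have hset : Set.pi s t = Set.pi (Finset.range (N + 1)) t' := by
    ext f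
    simp only [Set.mem_pi, Finset.mem_coe]
    constructor
    · intro h i _
      by_cases hi : i ∈ s
      · simpa [ht', hi] using h i hi
      · simp [ht', hi]
    · intro h i hi
      simpa [ht', hi] using h i (hN hi)
  have hprod : ∏ i ∈ s, μ (t i) = ∏ i ∈ Finset.range (N + 1), μ (t' i) := by
    rw [← Finset.prod_subset hN]
    · exact Finset.prod_congr rfl fun i hi => by simp [ht', hi]
    · intro i _ hi
      simp [ht', hi, μ]
  have hpre : consStep ⁻¹' Set.pi (Finset.range (N + 1)) t' =
      t' 0 ×ˢ Set.pi (Finset.range N) (fun i => t' (i + 1)) := by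
    ext ⟨a, f⟩
    simp only [Set.mem_preimage, Set.mem_pi, Finset.mem_coe, Finset.mem_range, Set.mem_prod]
    constructor
    · intro h
      exact ⟨h 0 (Nat.succ_pos N), fun i hi => h (i + 1) (by omega)⟩
    · rintro ⟨h0, h⟩ i hi
      cases i with
      | zero => exact h0
      | succ i => exact h i (by omega)
  rw [hset, hprod, Measure.map_apply measurable_consStep
    (MeasurableSet.pi (Finset.countable_toSet _) fun i _ => hmt' i), hpre, Measure.prod_prod,
    walkMeasure, Measure.infinitePi_pi _ (fun i _ => hmt' _), Finset.prod_range_succ', mul_comm]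

lemma integral_walkMeasure [NeZero d] {F : (ℕ → Fin d × Bool) → ℝ} (hF : Measurable F)
    {c : ℝ} (hc : ∀ s, |F s| ≤ c) :
    ∫ s, F s ∂walkMeasure d = stepAvg fun a => ∫ s, F (consStep (a, s)) ∂walkMeasure d := by
  conv_lhs => rw [← map_consStep]
  rw [integral_map measurable_consStep.aemeasurable hF.aestronglyMeasurable, integral_prod,
    PMF.integral_eq_sum]
  · simp [stepAvg, Finset.mul_sum, mul_comm]
  · exact Integrable.of_bound (hF.comp measurable_consStep).aestronglyMeasurable c
      (Eventually.of_forall fun p => hc _)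

/-! ### The survival probability as the limit of a recursion -/

lemma walk_consStep_succ (a : Fin d × Bool) (s : ℕ → Fin d × Bool) (n : ℕ) :
    walk (consStep (a, s)) (n + 1) = step a + walk s n := by
  simp only [walk, Finset.sum_range_succ', consStep]
  rw [add_comm]

@[simp]
lemma walk_zero (s : ℕ → Fin d × Bool) : walk s 0 = 0 := by simp [walk]

/-- The weight of a walk from `x` that reaches `y` within `n` steps; it is `0` if it does not. -/
def pathWeight (v : (Fin d → ℤ) → ℝ) (y : Fin d → ℤ) (n : ℕ) (x : Fin d → ℤ)
    (s : ℕ → Fin d × Bool) : ℝ :=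
  {s : ℕ → Fin d × Bool | ∃ m ≤ n, walk s m = y - x}.indicator
    (fun s => Real.exp (-∑ k ∈ Finset.range (firstPassage (y - x) s), v (x + walk s k))) s

lemma firstPassage_consStep {a : Fin d × Bool} {s : ℕ → Fin d × Bool} {x : Fin d → ℤ}
    (hx : x ≠ 0) (h : ∃ m, walk s m = x - step a) :
    firstPassage x (consStep (a, s)) = firstPassage (x - step a) s + 1 := by
  have hset : ∀ m, walk (consStep (a, s)) (m + 1) = x ↔ walk s m = x - step a := fun m => by
    rw [walk_consStep_succ, eq_sub_iff_add_eq, add_comm]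
  have hpos : 1 ≤ sInf {m | walk (consStep (a, s)) m = x} := by
    obtain ⟨m, hm⟩ := h
    rw [Nat.one_le_iff_ne_zero]
    intro h0
    rcases Nat.sInf_eq_zero.1 h0 with h1 | h1
    · exact hx (by simpa using (show walk (consStep (a, s)) 0 = x from h1).symm)
    · exact (Set.eq_empty_iff_forall_notMem.1 h1) (m + 1) ((hset m).2 hm)
  rw [firstPassage, firstPassage, ← Nat.sInf_add hpos]
  simp only [hset]

lemma pathWeight_self (v : (Fin d → ℤ) → ℝ) (n : ℕ) (s : ℕ → Fin d × Bool) :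
    pathWeight v y n y s = 1 := by
  have h0 : firstPassage (y - y) s = 0 := by
    refine Nat.sInf_eq_zero.2 (Or.inl ?_)
    simp
  rw [pathWeight, Set.indicator_of_mem, h0]
  · simp
  · exact ⟨0, Nat.zero_le n, by simp⟩

lemma pathWeight_zero_of_ne {x : Fin d → ℤ} (h : x ≠ y) (v : (Fin d → ℤ) → ℝ)
    (s : ℕ → Fin d × Bool) : pathWeight v y 0 x s = 0 := by
  rw [pathWeight, Set.indicator_of_notMem]
  rintro ⟨m, hm, hs⟩
  rw [Nat.le_zero.1 hm, walk_zero] at hs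
  exact h (sub_eq_zero.1 hs.symm).symm

lemma pathWeight_succ_of_ne {x : Fin d → ℤ} (h : x ≠ y) (v : (Fin d → ℤ) → ℝ) (n : ℕ)
    (a : Fin d × Bool) (s : ℕ → Fin d × Bool) :
    pathWeight v y (n + 1) x (consStep (a, s)) =
      Real.exp (-v x) * pathWeight v y n (x + step a) s := by
  have hsub : y - (x + step a) = y - x - step a := by abel
  have hyx : y - x ≠ 0 := fun h' => h (sub_eq_zero.1 h').symm
  have hiff : ∀ m, walk (consStep (a, s)) (m + 1) = y - x ↔ walk s m = y - x - step a := fun m => by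
    rw [walk_consStep_succ, eq_sub_iff_add_eq (a := walk s m), add_comm]
  simp only [pathWeight, hsub]
  by_cases hm : ∃ m ≤ n, walk s m = y - x - step a
  · have hmem : consStep (a, s) ∈ {s : ℕ → Fin d × Bool | ∃ m ≤ n + 1, walk s m = y - x} := by
      obtain ⟨m, hmn, hm⟩ := hm
      exact ⟨m + 1, by omega, (hiff m).2 hm⟩
    have hmem' : s ∈ {s : ℕ → Fin d × Bool | ∃ m ≤ n, walk s m = y - x - step a} := hm
    rw [Set.indicator_of_mem hmem, Set.indicator_of_mem hmem',
      firstPassage_consStep hyx (hm.imp fun m h => h.2), Finset.sum_range_succ', ← Real.exp_add]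
    simp only [walk_consStep_succ, walk_zero, add_zero, add_assoc]
    congr 1
    ring
  · have hmem : consStep (a, s) ∉ {s : ℕ → Fin d × Bool | ∃ m ≤ n + 1, walk s m = y - x} := by
      rintro ⟨m, hmn, hw⟩
      cases m with
      | zero => exact hyx (by simpa using hw.symm)
      | succ m => exact hm ⟨m, by omega, (hiff m).1 hw⟩
    have hmem' : s ∉ {s : ℕ → Fin d × Bool | ∃ m ≤ n, walk s m = y - x - step a} := hm
    rw [Set.indicator_of_notMem hmem, Set.indicator_of_notMem hmem', mul_zero]

lemma pathWeight_mem_Icc {v : (Fin d → ℤ) → ℝ} (hv : ∀ x, 0 ≤ v x) (n : ℕ) (x : Fin d → ℤ)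
    (s : ℕ → Fin d × Bool) : pathWeight v y n x s ∈ Set.Icc (0 : ℝ) 1 := by
  unfold pathWeight
  by_cases h : s ∈ {s : ℕ → Fin d × Bool | ∃ m ≤ n, walk s m = y - x}
  · rw [Set.indicator_of_mem h]
    refine ⟨(Real.exp_pos _).le, Real.exp_le_one_iff.2 ?_⟩
    exact neg_nonpos.2 (Finset.sum_nonneg fun k _ => hv _)
  · rw [Set.indicator_of_notMem h]
    exact ⟨le_rfl, zero_le_one⟩

lemma consStep_head_tail (s : ℕ → Fin d × Bool) : consStep (s 0, fun n => s (n + 1)) = s := by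
  ext1 n
  cases n <;> rfl

/-- The first-step recursion yields measurability by induction, without treating the first passage
time. -/
lemma measurable_pathWeight (v : (Fin d → ℤ) → ℝ) (n : ℕ) (x : Fin d → ℤ) :
    Measurable (pathWeight v y n x) := by
  induction n generalizing x with
  | zero =>
    by_cases h : x = y
    · subst h
      simp only [show pathWeight v x 0 x = fun _ => 1 from funext (pathWeight_self v 0)]
      exact measurable_const
    · rw [show pathWeight v y 0 x = fun _ => 0 from funext (pathWeight_zero_of_ne h v)]
      exact measurable_const
  | succ n ih =>
    by_cases h : x = y
    · subst h
      rw [show pathWeight v x (n + 1) x = fun _ => 1 from funext (pathWeight_self v (n + 1))]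
      exact measurable_const
    · have : pathWeight v y (n + 1) x = (fun p : (Fin d × Bool) × (ℕ → Fin d × Bool) =>
          Real.exp (-v x) * pathWeight v y n (x + step p.1) p.2) ∘
            fun s => (s 0, fun n => s (n + 1)) := by
        ext s
        conv_lhs => rw [← consStep_head_tail s, pathWeight_succ_of_ne h]
        rfl
      rw [this]
      have h1 : Measurable fun p : (Fin d × Bool) × (ℕ → Fin d × Bool) =>
          Real.exp (-v x) * pathWeight v y n (x + step p.1) p.2 :=
        measurable_from_prod_countable_right fun a => (ih (x + step a)).const_mul _
      have h2 : Measurable fun s : ℕ → Fin d × Bool => (s 0, fun n => s (n + 1)) :=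
        (measurable_pi_apply 0).prodMk
          (measurable_pi_lambda _ fun n => measurable_pi_apply (n + 1))
      exact h1.comp h2

/-- The quenched weight of the walks from `x` that reach `y` within `n` steps. -/
def quenched (v : (Fin d → ℤ) → ℝ) (y : Fin d → ℤ) : ℕ → (Fin d → ℤ) → ℝ
  | 0, x => if x = y then 1 else 0
  | n + 1, x => if x = y then 1 else
      Real.exp (-v x) * stepAvg fun a => quenched v y n (x + step a)

lemma integral_pathWeight [NeZero d] {v : (Fin d → ℤ) → ℝ} (hv : ∀ x, 0 ≤ v x) (n : ℕ)
    (x : Fin d → ℤ) : ∫ s, pathWeight v y n x s ∂walkMeasure d = quenched v y n x := by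
  induction n generalizing x with
  | zero =>
    by_cases h : x = y
    · subst h; simp [pathWeight_self, quenched]
    · simp [pathWeight_zero_of_ne h, quenched, h]
  | succ n ih =>
    by_cases h : x = y
    · subst h; simp [pathWeight_self, quenched]
    · rw [integral_walkMeasure (measurable_pathWeight v _ x) (c := 1)]
      · simp only [pathWeight_succ_of_ne h, integral_const_mul, ih]
        rw [stepAvg_mul_left]
        simp [quenched, h]
      · intro s
        have := pathWeight_mem_Icc (y := y) hv (n + 1) x s
        rw [abs_of_nonneg this.1]
        exact this.2

lemma quenched_mem_Icc [NeZero d] {v : (Fin d → ℤ) → ℝ} (hv : ∀ x, 0 ≤ v x) (n : ℕ)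
    (x : Fin d → ℤ) : quenched v y n x ∈ Set.Icc (0 : ℝ) 1 := by
  rw [← integral_pathWeight hv]
  refine ⟨integral_nonneg fun s => (pathWeight_mem_Icc hv n x s).1, ?_⟩
  have := integral_mono (μ := walkMeasure d) (f := pathWeight v y n x) (g := fun _ => 1)
    (Integrable.of_bound (measurable_pathWeight v n x).aestronglyMeasurable 1
      (Eventually.of_forall fun s => by
        have := pathWeight_mem_Icc (y := y) hv n x s
        rw [Real.norm_eq_abs, abs_of_nonneg this.1]
        exact this.2)) (integrable_const 1) fun s => (pathWeight_mem_Icc hv n x s).2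
  simpa using this

lemma tendsto_quenched [NeZero d] {v : (Fin d → ℤ) → ℝ} (hv : ∀ x, 0 ≤ v x) (y : Fin d → ℤ) :
    Tendsto (fun n => quenched v y n 0) atTop (𝓝 (survival y v)) := by
  simp only [← integral_pathWeight hv]
  unfold survival
  refine tendsto_integral_of_dominated_convergence (fun _ => 1)
    (fun n => (measurable_pathWeight v n 0).aestronglyMeasurable) (integrable_const 1)
    (fun n => Eventually.of_forall fun s => ?_) (Eventually.of_forall fun s => ?_)
  · have := pathWeight_mem_Icc (y := y) hv n 0 s
    rw [Real.norm_eq_abs, abs_of_nonneg this.1]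
    exact this.2
  · refine tendsto_const_nhds.congr' ?_
    simp only [pathWeight, sub_zero, zero_add]
    by_cases h : ∃ m, walk s m = y
    · obtain ⟨m, hm⟩ := h
      filter_upwards [eventually_ge_atTop m] with n hn
      rw [Set.indicator_of_mem (show s ∈ {s | ∃ n, walk s n = y} from ⟨m, hm⟩),
        Set.indicator_of_mem (show s ∈ {s | ∃ m ≤ n, walk s m = y} from ⟨m, hn, hm⟩)]
    · refine Eventually.of_forall fun n => ?_
      beta_reduce
      rw [Set.indicator_of_notMem (show s ∉ {s | ∃ n, walk s n = y} from h),
        Set.indicator_of_notMem (show s ∉ {s | ∃ m ≤ n, walk s m = y} from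
          fun ⟨m, _, hm⟩ => h ⟨m, hm⟩)]

/-! ### Averaging over the potential -/

section

variable {Ω : Type*} [MeasurableSpace Ω] {P : Measure Ω} {V : (Fin d → ℤ) → Ω → ℝ}

/-- The Laplace transform `k ↦ 𝔼[exp(-k W)]`. -/
def laplace (P : Measure Ω) (W : Ω → ℝ) (k : ℕ) : ℝ := ∫ ω, Real.exp (-(k * W ω)) ∂P

lemma integrable_exp_neg [IsFiniteMeasure P] {W : Ω → ℝ} (hW : Measurable W) (h0 : ∀ ω, 0 ≤ W ω) :
    Integrable (fun ω => Real.exp (-W ω)) P :=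
  Integrable.of_bound hW.neg.exp.aestronglyMeasurable 1 (Eventually.of_forall fun ω => by
    rw [Real.norm_eq_abs, Real.abs_exp]
    exact Real.exp_le_one_iff.2 (neg_nonpos.2 (h0 ω)))

/-- The substantial property is `mul_le`: `exp(-j W)` and `exp(-k W)` are both decreasing in `W`,
hence positively correlated. -/
lemma isLocalWeight_laplace [IsProbabilityMeasure P] {W : Ω → ℝ} (hW : Measurable W)
    (h0 : ∀ ω, 0 ≤ W ω) : IsLocalWeight (laplace P W) := by
  have hInt : ∀ k : ℕ, Integrable (fun ω => Real.exp (-(k * W ω))) P := fun k =>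
    integrable_exp_neg (hW.const_mul _) fun ω => mul_nonneg (Nat.cast_nonneg k) (h0 ω)
  have hpos : ∀ k, 0 < laplace P W k := fun k => integral_exp_pos (hInt k)
  refine ⟨by simp [laplace], hpos, fun j k hjk => ?_, fun j k => ?_⟩
  · refine integral_mono (hInt k) (hInt j) fun ω => Real.exp_le_exp.2 ?_
    exact neg_le_neg (mul_le_mul_of_nonneg_right (Nat.cast_le.2 hjk) (h0 ω))
  · rcases Nat.eq_zero_or_pos j with rfl | hj
    · simp [laplace]
    have hj' : (0 : ℝ) < j := Nat.cast_pos.2 hj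
    set m := laplace P W j
    -- At `W = t` the first exponential equals its mean `m` and the second equals `g`, so both
    -- differences change sign together and their product is nonnegative. In the mean of the product
    -- the constant `g` cancels.
    set t := -Real.log m / j
    have hm : Real.exp (-(j * t)) = m := by
      rw [show -((j : ℝ) * t) = Real.log m by simp only [t]; field_simp,
        Real.exp_log (hpos j)]
    set g := Real.exp (-(k * t))
    have hpt : ∀ ω, 0 ≤ (Real.exp (-(j * W ω)) - m) * (Real.exp (-(k * W ω)) - g) := by
      intro ω
      rw [← hm]
      rcases le_total (W ω) t with h | h
      · refine mul_nonneg (sub_nonneg.2 (Real.exp_le_exp.2 ?_))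
          (sub_nonneg.2 (Real.exp_le_exp.2 ?_)) <;>
        exact neg_le_neg (mul_le_mul_of_nonneg_left h (Nat.cast_nonneg _))
      · refine mul_nonneg_of_nonpos_of_nonpos (sub_nonpos.2 (Real.exp_le_exp.2 ?_))
          (sub_nonpos.2 (Real.exp_le_exp.2 ?_)) <;>
        exact neg_le_neg (mul_le_mul_of_nonneg_left h (Nat.cast_nonneg _))
    have heq : ∀ ω, (Real.exp (-(j * W ω)) - m) * (Real.exp (-(k * W ω)) - g) =
        Real.exp (-((j + k : ℕ) * W ω)) - m * Real.exp (-(k * W ω)) -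
          (g * Real.exp (-(j * W ω)) - m * g) := by
      intro ω
      have : Real.exp (-((j + k : ℕ) * W ω)) =
          Real.exp (-(j * W ω)) * Real.exp (-(k * W ω)) := by
        rw [← Real.exp_add]; push_cast; congr 1; ring
      rw [this]; ring
    have h := integral_nonneg_of_ae (μ := P) (Eventually.of_forall hpt)
    simp only [heq] at h
    have hk := (hInt k).const_mul m
    have hj := (hInt j).const_mul g
    rw [integral_sub (f := fun ω => Real.exp (-((j + k : ℕ) * W ω)) - m * Real.exp (-(k * W ω)))
        (g := fun ω => g * Real.exp (-(j * W ω)) - m * g)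
        ((hInt (j + k)).sub hk) (hj.sub (integrable_const _)),
      integral_sub (hInt (j + k)) hk, integral_sub hj (integrable_const _),
      integral_const_mul, integral_const_mul] at h
    simp only [integral_const, probReal_univ, one_smul] at h
    change 0 ≤ laplace P W (j + k) - m * laplace P W k - (g * m - m * g) at h
    linarith

lemma IsIIDPotential.integral_exp_sum [IsProbabilityMeasure P] (hV : IsIIDPotential P V)
    (L : (Fin d → ℤ) →₀ ℕ) :
    ∫ ω, Real.exp (-L.sum fun z k => (k : ℝ) * V z ω) ∂P = fieldWeight (laplace P (V 0)) L := by
  have hexp : ∀ ω, Real.exp (-L.sum fun z k => (k : ℝ) * V z ω) =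
      ∏ z : L.support, Real.exp (-(L z * V z ω)) := by
    intro ω
    rw [Finsupp.sum, ← Finset.sum_neg_distrib, Real.exp_sum, ← Finset.prod_coe_sort]
  simp only [hexp]
  have hind : iIndepFun (fun z : L.support => V z) P := hV.indep.precomp Subtype.val_injective
  rw [hind.integral_fun_prod_comp (f := fun (z : L.support) (t : ℝ) => Real.exp (-(L z * t)))
    (fun z => (hV.measurable z).aemeasurable)
    (fun z => (by fun_prop : Measurable fun t : ℝ => Real.exp (-(L z * t))).aestronglyMeasurable),
    fieldWeight, Finsupp.prod, ← Finset.prod_coe_sort L.support fun z => laplace P (V 0) (L z)]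
  refine Finset.prod_congr rfl fun z _ => ?_
  exact ((hV.identDistrib z).comp
    (by fun_prop : Measurable fun t : ℝ => Real.exp (-(L z * t)))).integral_eq

lemma IsIIDPotential.measurable_quenched (hV : IsIIDPotential P V) (n : ℕ) (x : Fin d → ℤ) :
    Measurable fun ω => quenched (fun x => V x ω) y n x := by
  induction n generalizing x with
  | zero => simp only [quenched]; exact measurable_const
  | succ n ih =>
    simp only [quenched]
    split_ifs
    · exact measurable_const
    · refine (hV.measurable x).neg.exp.mul (Measurable.const_mul ?_ _)
      exact Finset.measurable_fun_sum _ fun a _ => ih _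

/-- With the past kept as the prefactor `exp(-∑ L(z) V(z))`, the quenched factor `exp(-V x)` of one
step is one more unit of local time at `x`. -/
lemma IsIIDPotential.integral_quenched [NeZero d] [IsProbabilityMeasure P]
    (hV : IsIIDPotential P V) (n : ℕ) (x : Fin d → ℤ) (L : (Fin d → ℤ) →₀ ℕ) :
    ∫ ω, Real.exp (-L.sum fun z k => (k : ℝ) * V z ω) * quenched (fun x => V x ω) y n x ∂P =
      annealed (laplace P (V 0)) y n x L := by
  classical
  have hmeas : ∀ L : (Fin d → ℤ) →₀ ℕ, Measurable fun ω => L.sum fun z k => (k : ℝ) * V z ω :=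
    fun L => Finset.measurable_fun_sum _ fun z _ => (hV.measurable z).const_mul _
  have hnonneg : ∀ (L : (Fin d → ℤ) →₀ ℕ) ω, 0 ≤ L.sum fun z k => (k : ℝ) * V z ω :=
    fun L ω => Finset.sum_nonneg fun z _ => mul_nonneg (Nat.cast_nonneg _) (hV.nonneg z ω)
  induction n generalizing x L with
  | zero =>
    by_cases h : x = y
    · simp [quenched, annealed, h, hV.integral_exp_sum]
    · simp [quenched, annealed, h]
  | succ n ih =>
    by_cases h : x = y
    · simp [quenched, annealed, h, hV.integral_exp_sum]
    · rw [annealed_succ_of_ne h]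
      simp only [← ih]
      simp only [quenched, if_neg h, stepAvg]
      rw [← integral_finsetSum, ← integral_const_mul]
      · refine integral_congr_ae (Eventually.of_forall fun ω => ?_)
        have : (L + Finsupp.single x 1).sum (fun z k => (k : ℝ) * V z ω) =
            L.sum (fun z k => (k : ℝ) * V z ω) + V x ω := by
          rw [Finsupp.sum_add_index' (by simp) (by intros; push_cast; ring)]
          simp
        simp only [this, neg_add, Real.exp_add, ← Finset.mul_sum]
        ring
      · intro a _
        refine (integrable_exp_neg (hmeas _) (hnonneg _)).mul_bdd (c := 1)
          (hV.measurable_quenched n _).aestronglyMeasurable (Eventually.of_forall fun ω => ?_)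
        have := quenched_mem_Icc (y := y) (fun x => hV.nonneg x ω) n (x + step a)
        rw [Real.norm_eq_abs, abs_of_nonneg this.1]
        exact this.2

/-- The annealed survival probability. -/
def annealedSurvival (φ : ℕ → ℝ) (y : Fin d → ℤ) : ℝ := ⨆ n, annealed φ y n 0 0

lemma IsLocalWeight.tendsto_annealed [NeZero d] (hφ : IsLocalWeight φ) (y : Fin d → ℤ) :
    Tendsto (fun n => annealed φ y n 0 0) atTop (𝓝 (annealedSurvival φ y)) :=
  tendsto_atTop_ciSup (hφ.annealed_monotone 0 0) ⟨1, by
    rintro _ ⟨n, rfl⟩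
    exact (hφ.annealed_le_fieldWeight n 0 0).trans (hφ.fieldWeight_le_one 0)⟩

lemma IsIIDPotential.integral_survival [NeZero d] [IsProbabilityMeasure P]
    (hV : IsIIDPotential P V) (y : Fin d → ℤ) :
    ∫ ω, survival y (fun x => V x ω) ∂P = annealedSurvival (laplace P (V 0)) y := by
  refine tendsto_nhds_unique ?_
    ((isLocalWeight_laplace (hV.measurable 0) (hV.nonneg 0)).tendsto_annealed y)
  have : ∀ n, annealed (laplace P (V 0)) y n 0 0 =
      ∫ ω, quenched (fun x => V x ω) y n 0 ∂P := fun n => by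
    simp [← hV.integral_quenched]
  simp only [this]
  refine tendsto_integral_of_dominated_convergence (fun _ => 1)
    (fun n => (hV.measurable_quenched n 0).aestronglyMeasurable) (integrable_const 1)
    (fun n => Eventually.of_forall fun ω => ?_)
    (Eventually.of_forall fun ω => tendsto_quenched (fun x => hV.nonneg x ω) y)
  have := quenched_mem_Icc (y := y) (fun x => hV.nonneg x ω) n 0
  rw [Real.norm_eq_abs, abs_of_nonneg this.1]
  exact this.2

end

/-! ### Seminorms and lattice points -/

lemma toEuclidean_add (x y : Fin d → ℤ) : toEuclidean (x + y) = toEuclidean x + toEuclidean y := by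
  ext i; simp [toEuclidean]

/-- `toEuclidean` as an additive map. -/
def toEuclideanHom : (Fin d → ℤ) →+ EuclideanSpace ℝ (Fin d) :=
  AddMonoidHom.mk' toEuclidean toEuclidean_add

@[simp]
lemma toEuclideanHom_apply (z : Fin d → ℤ) : toEuclideanHom z = toEuclidean z := rfl

lemma lattice_eq_sum (z : Fin d → ℤ) : z = ∑ i, z i • (Pi.single i 1 : Fin d → ℤ) := by
  ext j
  simp [Finset.sum_apply, Pi.single_apply]

lemma le_of_forall_nat_mul_le {s t D : ℝ} (h : ∀ k : ℕ, k * s ≤ k * t + D) : s ≤ t := by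
  by_contra! hlt
  obtain ⟨k, hk⟩ := exists_nat_gt (D / (s - t))
  rw [div_lt_iff₀ (sub_pos.2 hlt)] at hk
  linarith [h k]

/-- Rounding `k • x` down to the lattice makes an error bounded in `p` and `q` uniformly in `k`; it
disappears after division by `k`. -/
lemma seminorm_le_of_lattice {p q : Seminorm ℝ (EuclideanSpace ℝ (Fin d))}
    (h : ∀ z, p (toEuclidean z) ≤ q (toEuclidean z)) : p ≤ q := by
  intro x
  set e : Fin d → EuclideanSpace ℝ (Fin d) := fun i => EuclideanSpace.single i 1
  have hrem : ∀ (p : Seminorm ℝ (EuclideanSpace ℝ (Fin d))) (k : ℕ),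
      p ((k : ℝ) • x - toEuclidean fun i => ⌊k * x i⌋) ≤ ∑ i, p (e i) := by
    intro p k
    have : (k : ℝ) • x - toEuclidean (fun i => ⌊k * x i⌋) =
        ∑ i, Int.fract (k * x i) • e i := by
      ext j
      simp [toEuclidean, e, Finset.sum_apply, Pi.single_apply]
    rw [this]
    refine (Finset.le_sum_of_subadditive p (map_zero p).le (map_add_le_add p) _ _).trans
      (Finset.sum_le_sum fun i _ => ?_)
    rw [map_smul_eq_mul, Real.norm_eq_abs, abs_of_nonneg (Int.fract_nonneg _)]
    exact mul_le_of_le_one_left (apply_nonneg p _) (Int.fract_lt_one _).le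
  refine le_of_forall_nat_mul_le (D := ∑ i, p (e i) + ∑ i, q (e i)) fun k => ?_
  set w := toEuclidean fun i => ⌊k * x i⌋
  have hk : ∀ p : Seminorm ℝ (EuclideanSpace ℝ (Fin d)), p ((k : ℝ) • x) = k * p x := fun p => by
    rw [map_smul_eq_mul, Real.norm_natCast]
  have h1 : p ((k : ℝ) • x) ≤ p w + p ((k : ℝ) • x - w) := by
    simpa using map_add_le_add p w ((k : ℝ) • x - w)
  have h2 : q w ≤ q ((k : ℝ) • x) + q ((k : ℝ) • x - w) := by
    have := map_sub_le_add q ((k : ℝ) • x) ((k : ℝ) • x - w)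
    simpa using this
  rw [hk] at h1 h2
  linarith [hrem p k, hrem q k, h fun i => ⌊k * x i⌋]

lemma seminorm_eq_of_lattice {p q : Seminorm ℝ (EuclideanSpace ℝ (Fin d))}
    (h : ∀ z, p (toEuclidean z) = q (toEuclidean z)) : p = q :=
  le_antisymm (seminorm_le_of_lattice fun z => (h z).le)
    (seminorm_le_of_lattice fun z => (h z).ge)

section Extension

variable {B : (Fin d → ℤ) → ℝ}

lemma map_zsmul_of_even (hneg : ∀ z, B (-z) = B z) (hsmul : ∀ (m : ℕ) z, B (m • z) = m * B z)
    (m : ℤ) (z : Fin d → ℤ) : B (m • z) = |(m : ℝ)| * B z := by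
  obtain ⟨n, rfl | rfl⟩ := m.eq_nat_or_neg
  · rw [natCast_zsmul, hsmul]; simp
  · rw [neg_smul, hneg, natCast_zsmul, hsmul]; simp

lemma le_mul_norm_toEuclidean (h0 : ∀ z, 0 ≤ B z) (hadd : ∀ x y, B (x + y) ≤ B x + B y)
    (hneg : ∀ z, B (-z) = B z) (hsmul : ∀ (m : ℕ) z, B (m • z) = m * B z) (z : Fin d → ℤ) :
    B z ≤ (∑ i, B (Pi.single i 1)) * ‖toEuclidean z‖ := by
  have hz : B 0 = 0 := by simpa using hsmul 0 0
  conv_lhs => rw [lattice_eq_sum z]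
  refine (Finset.le_sum_of_subadditive B hz.le hadd _ _).trans ?_
  rw [Finset.sum_mul]
  refine Finset.sum_le_sum fun i _ => ?_
  rw [map_zsmul_of_even hneg hsmul, mul_comm]
  refine mul_le_mul_of_nonneg_left ?_ (h0 _)
  simpa [toEuclidean] using PiLp.norm_apply_le (toEuclidean z) i

/-- The cost of representing `x`, up to an error, as the combination `f` of lattice points. -/
def combinationCost (B : (Fin d → ℤ) → ℝ) (M : ℝ) (x : EuclideanSpace ℝ (Fin d))
    (f : (Fin d → ℤ) →₀ ℝ) : ℝ :=
  (f.sum fun z t => |t| * B z) + M * ‖x - f.sum fun z t => t • toEuclidean z‖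

/-- Scale by `k` and round the coefficients `k * f z` to integers, so that subadditivity on the
lattice applies. The rounding error does not grow with `k`. -/
lemma le_combinationCost (h0 : ∀ z, 0 ≤ B z) (hadd : ∀ x y, B (x + y) ≤ B x + B y)
    (hneg : ∀ z, B (-z) = B z) (hsmul : ∀ (m : ℕ) z, B (m • z) = m * B z) {M : ℝ} (hM : 0 ≤ M)
    (hB : ∀ z, B z ≤ M * ‖toEuclidean z‖) (w : Fin d → ℤ) (f : (Fin d → ℤ) →₀ ℝ) :
    B w ≤ combinationCost B M (toEuclidean w) f := by
  have hz : B 0 = 0 := by simpa using hsmul 0 0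
  refine le_of_forall_nat_mul_le
    (D := ∑ z ∈ f.support, (B z + M * ‖toEuclidean z‖)) fun k => ?_
  set m : (Fin d → ℤ) → ℤ := fun z => ⌊k * f z⌋
  set u := ∑ z ∈ f.support, m z • z
  set T := f.sum fun z t => t • toEuclidean z
  have h1 : B (k • w) ≤ B u + B (k • w - u) := by simpa using hadd u (k • w - u)
  have h2 : B u ≤ ∑ z ∈ f.support, (k * (|f z| * B z) + B z) := by
    refine (Finset.le_sum_of_subadditive B hz.le hadd _ _).trans (Finset.sum_le_sum fun z _ => ?_)
    rw [map_zsmul_of_even hneg hsmul]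
    have : |(m z : ℝ)| ≤ k * |f z| + 1 := by
      have h3 : |(m z : ℝ) - k * f z| ≤ 1 := by
        rw [abs_le]
        constructor <;> linarith [Int.floor_le (k * f z), Int.lt_floor_add_one (k * f z)]
      have h4 := abs_add_le ((m z : ℝ) - k * f z) (k * f z)
      rw [sub_add_cancel, abs_mul, Nat.abs_cast] at h4
      linarith
    nlinarith [h0 z]
  have h3 : toEuclidean (k • w - u) = (k : ℝ) • (toEuclidean w - T) +
      ∑ z ∈ f.support, Int.fract (k * f z) • toEuclidean z := by
    rw [← toEuclideanHom_apply, map_sub, map_nsmul, map_sum]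
    simp only [map_zsmul, toEuclideanHom_apply, Int.fract, sub_smul, Finset.sum_sub_distrib,
      smul_sub, T, Finsupp.sum, Finset.smul_sum, mul_smul, m, Nat.cast_smul_eq_nsmul,
      Int.cast_smul_eq_zsmul]
    abel
  have h4 : ‖toEuclidean (k • w - u)‖ ≤ k * ‖toEuclidean w - T‖ +
      ∑ z ∈ f.support, ‖toEuclidean z‖ := by
    rw [h3]
    refine (norm_add_le _ _).trans (add_le_add ?_ ((norm_sum_le _ _).trans
      (Finset.sum_le_sum fun z _ => ?_)))
    · rw [norm_smul, Real.norm_natCast]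
    · rw [norm_smul, Real.norm_eq_abs, abs_of_nonneg (Int.fract_nonneg _)]
      exact mul_le_of_le_one_left (norm_nonneg _) (Int.fract_lt_one _).le
  have h5 := (hB (k • w - u)).trans (mul_le_mul_of_nonneg_left h4 hM)
  rw [hsmul] at h1
  rw [Finset.sum_add_distrib, ← Finset.mul_sum] at h2
  rw [Finset.sum_add_distrib, ← Finset.mul_sum]
  simp only [combinationCost, Finsupp.sum, T] at *
  linarith

lemma combinationCost_nonneg (h0 : ∀ z, 0 ≤ B z) {M : ℝ} (hM : 0 ≤ M)
    (x : EuclideanSpace ℝ (Fin d)) (f : (Fin d → ℤ) →₀ ℝ) : 0 ≤ combinationCost B M x f :=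
  add_nonneg (Finset.sum_nonneg fun z _ => mul_nonneg (abs_nonneg _) (h0 z))
    (mul_nonneg hM (norm_nonneg _))

/-- An even, homogeneous and subadditive function on the lattice extends to a seminorm. -/
lemma exists_seminorm_eq (h0 : ∀ z, 0 ≤ B z) (hadd : ∀ x y, B (x + y) ≤ B x + B y)
    (hneg : ∀ z, B (-z) = B z) (hsmul : ∀ (m : ℕ) z, B (m • z) = m * B z) :
    ∃ p : Seminorm ℝ (EuclideanSpace ℝ (Fin d)), ∀ z, p (toEuclidean z) = B z := by
  classical
  set M := ∑ i : Fin d, B (Pi.single i 1)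
  have hM : 0 ≤ M := Finset.sum_nonneg fun i _ => h0 _
  have hB := le_mul_norm_toEuclidean h0 hadd hneg hsmul
  have hbdd : ∀ x, BddBelow (Set.range (combinationCost B M x)) := fun x =>
    ⟨0, by rintro _ ⟨f, rfl⟩; exact combinationCost_nonneg h0 hM x f⟩
  have hnn : ∀ x, 0 ≤ ⨅ f, combinationCost B M x f := fun x =>
    le_ciInf (combinationCost_nonneg h0 hM x)
  refine ⟨Seminorm.ofSMulLE (fun x => ⨅ f, combinationCost B M x f) ?_ ?_ ?_, fun z => ?_⟩
  · refine le_antisymm ((ciInf_le (hbdd 0) 0).trans ?_) (hnn 0)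
    simp [combinationCost]
  · intro x y
    refine le_ciInf_add_ciInf fun f g => (ciInf_le (hbdd _) (f + g)).trans ?_
    have h1 : ((f + g).sum fun z t => |t| * B z) ≤
        (f.sum fun z t => |t| * B z) + g.sum fun z t => |t| * B z := by
      rw [Finsupp.sum_of_support_subset (f + g) Finsupp.support_add _ (by simp),
        Finsupp.sum_of_support_subset f (Finset.subset_union_left (s₂ := g.support)) _ (by simp),
        Finsupp.sum_of_support_subset g (Finset.subset_union_right (s₁ := f.support)) _ (by simp),
        ← Finset.sum_add_distrib]
      refine Finset.sum_le_sum fun z _ => ?_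
      rw [← add_mul]
      exact mul_le_mul_of_nonneg_right (abs_add_le _ _) (h0 z)
    have h2 : ((f + g).sum fun z t => t • toEuclidean z) =
        (f.sum fun z t => t • toEuclidean z) + g.sum fun z t => t • toEuclidean z :=
      Finsupp.sum_add_index' (by simp) (by intros; rw [add_smul])
    have h3 := mul_le_mul_of_nonneg_left (norm_add_le (x - f.sum fun z t => t • toEuclidean z)
      (y - g.sum fun z t => t • toEuclidean z)) hM
    rw [← add_sub_add_comm, ← h2] at h3
    simp only [combinationCost]
    linarith
  · intro r x
    rw [Real.mul_iInf_of_nonneg (norm_nonneg r)]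
    refine le_ciInf fun f => (ciInf_le (hbdd _) (r • f)).trans (le_of_eq ?_)
    have h2 : ((r • f).sum fun z t => t • toEuclidean z) =
        r • f.sum fun z t => t • toEuclidean z := by
      rw [Finsupp.sum_smul_index' (by simp), Finsupp.smul_sum]
      simp only [smul_eq_mul, mul_smul]
    have h1 : ((r • f).sum fun z t => |t| * B z) = ‖r‖ * f.sum fun z t => |t| * B z := by
      rw [Finsupp.sum_smul_index' (by simp), Finsupp.mul_sum]
      simp only [smul_eq_mul, abs_mul, Real.norm_eq_abs, mul_assoc]
    rw [combinationCost, h1, h2, ← smul_sub, norm_smul, combinationCost]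
    ring
  · refine le_antisymm ((ciInf_le (hbdd _) (Finsupp.single z 1)).trans ?_)
      (le_ciInf (le_combinationCost h0 hadd hneg hsmul hM hB z))
    simp [combinationCost]

end Extension

/-! ### The annealed exponent of a local weight -/

lemma annealedSurvival_neg (φ : ℕ → ℝ) (y : Fin d → ℤ) :
    annealedSurvival φ (-y) = annealedSurvival φ y := by
  simp only [annealedSurvival, annealed_neg]

namespace IsLocalWeight

variable [NeZero d]

lemma annealed_le_annealedSurvival (hφ : IsLocalWeight φ) (n : ℕ) (y : Fin d → ℤ) :
    annealed φ y n 0 0 ≤ annealedSurvival φ y :=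
  (hφ.annealed_monotone 0 0).ge_of_tendsto (hφ.tendsto_annealed y) n

lemma annealedSurvival_le (hφ : IsLocalWeight φ) {c : ℝ} (h : ∀ n, annealed φ y n 0 0 ≤ c) :
    annealedSurvival φ y ≤ c :=
  le_of_tendsto' (hφ.tendsto_annealed y) h

lemma annealedSurvival_le_one (hφ : IsLocalWeight φ) (y : Fin d → ℤ) :
    annealedSurvival φ y ≤ 1 :=
  hφ.annealedSurvival_le fun n =>
    (hφ.annealed_le_fieldWeight n 0 0).trans (hφ.fieldWeight_le_one 0)

lemma annealedSurvival_mul_le (hφ : IsLocalWeight φ) (x y : Fin d → ℤ) :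
    annealedSurvival φ x * annealedSurvival φ y ≤ annealedSurvival φ (x + y) := by
  refine le_of_tendsto' ((hφ.tendsto_annealed x).mul (hφ.tendsto_annealed y)) fun n => ?_
  refine le_trans ?_ (hφ.annealed_le_annealedSurvival (n + n) (x + y))
  have := hφ.annealed_mul_le (y := x) (z := x + y) n n 0 0
  rwa [← annealed_translate (φ := φ) x n 0 (y := y), add_zero]

lemma annealedSurvival_step_pos (hφ : IsLocalWeight φ) (a : Fin d × Bool) :
    0 < annealedSurvival φ (step a) := by
  have hd : (0 : ℝ) < d := Nat.cast_pos.2 (Nat.pos_of_ne_zero (NeZero.ne d))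
  have hne : (0 : Fin d → ℤ) ≠ step a := by
    intro h
    have := congrFun h a.1
    simp only [step, Pi.zero_apply, Pi.single_eq_same] at this
    cases h2 : a.2 <;> simp [h2] at this
  refine lt_of_lt_of_le ?_ (hφ.annealed_le_annealedSurvival 1 (step a))
  rw [annealed_succ_of_ne hne]
  refine lt_of_lt_of_le ?_ (le_stepAvg (fun b => hφ.annealed_nonneg _ _ _) a)
  rw [zero_add, annealed_self]
  exact mul_pos (by positivity) (hφ.fieldWeight_pos _)

lemma annealedSurvival_pos (hφ : IsLocalWeight φ) (y : Fin d → ℤ) :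
    0 < annealedSurvival φ y := by
  -- By supermultiplicativity and symmetry the sites reached with positive weight form a subgroup,
  -- and it contains the unit vectors.
  let S : AddSubgroup (Fin d → ℤ) :=
    { carrier := {y | 0 < annealedSurvival φ y}
      zero_mem' := by
        refine lt_of_lt_of_le one_pos ((le_of_eq ?_).trans (hφ.annealed_le_annealedSurvival 0 0))
        rw [annealed_self, fieldWeight_zero]
      add_mem' := fun {x y} hx hy => (mul_pos hx hy).trans_le (hφ.annealedSurvival_mul_le x y)
      neg_mem' := fun {x} hx => by
        change 0 < annealedSurvival φ (-x)
        rw [annealedSurvival_neg]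
        exact hx }
  change y ∈ S
  rw [lattice_eq_sum y]
  exact sum_mem fun i _ => zsmul_mem (hφ.annealedSurvival_step_pos (i, true)) _

/-- The annealed cost of reaching `k • z` grows at a linear rate in `k`, and the rate is the
restriction of a seminorm to the lattice. -/
lemma exists_seminorm_tendsto (hφ : IsLocalWeight φ) :
    ∃ p : Seminorm ℝ (EuclideanSpace ℝ (Fin d)), ∀ z : Fin d → ℤ,
      Tendsto (fun k : ℕ => -Real.log (annealedSurvival φ (k • z)) / k) atTop
        (𝓝 (p (toEuclidean z))) := by
  set b : (Fin d → ℤ) → ℝ := fun z => -Real.log (annealedSurvival φ z) with hb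
  have hb0 : ∀ z, 0 ≤ b z := fun z => neg_nonneg.2
    (Real.log_nonpos (hφ.annealedSurvival_pos z).le (hφ.annealedSurvival_le_one z))
  have hbadd : ∀ x y, b (x + y) ≤ b x + b y := fun x y => by
    have := Real.log_le_log (mul_pos (hφ.annealedSurvival_pos x) (hφ.annealedSurvival_pos y))
      (hφ.annealedSurvival_mul_le x y)
    rw [Real.log_mul (hφ.annealedSurvival_pos x).ne' (hφ.annealedSurvival_pos y).ne'] at this
    simp only [hb]
    linarith
  have hbneg : ∀ z, b (-z) = b z := fun z => by simp only [hb, annealedSurvival_neg]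
  have hsub : ∀ z, Subadditive fun k : ℕ => b (k • z) := fun z m n => by
    simp only [add_smul]; exact hbadd _ _
  have hlim : ∀ z, Tendsto (fun k : ℕ => b (k • z) / k) atTop (𝓝 (hsub z).lim) := fun z =>
    (hsub z).tendsto_lim ⟨0, by
      rintro _ ⟨n, rfl⟩
      exact div_nonneg (hb0 _) (Nat.cast_nonneg n)⟩
  obtain ⟨p, hp⟩ := exists_seminorm_eq (B := fun z => (hsub z).lim)
    (fun z => ge_of_tendsto' (hlim z) fun k => div_nonneg (hb0 _) (Nat.cast_nonneg k))
    (fun x y => le_of_tendsto_of_tendsto' (hlim (x + y)) ((hlim x).add (hlim y)) fun k => by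
      rw [← add_div, smul_add]
      exact div_le_div_of_nonneg_right (hbadd _ _) (Nat.cast_nonneg k))
    (fun z => tendsto_nhds_unique (hlim (-z)) ((hlim z).congr fun k => by
      rw [smul_neg, hbneg]))
    (fun m z => by
      rcases Nat.eq_zero_or_pos m with rfl | hm
      · refine tendsto_nhds_unique (hlim _) ?_
        have h00 : b 0 = 0 := by
          refine le_antisymm ?_ (hb0 0)
          have : (1 : ℝ) ≤ annealedSurvival φ (0 : Fin d → ℤ) := by
            refine (le_of_eq ?_).trans (hφ.annealed_le_annealedSurvival 0 0)
            rw [annealed_self, fieldWeight_zero]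
          exact neg_nonpos.2 (Real.log_nonneg this)
        simp [h00]
      · have hm' : (m : ℝ) ≠ 0 := Nat.cast_ne_zero.2 hm.ne'
        refine tendsto_nhds_unique (hlim (m • z)) ?_
        -- Homogeneity comes from the limit along the multiples `k * m`.
        have := ((hlim z).comp (tendsto_id.atTop_mul_const' hm)).const_mul (m : ℝ)
        refine this.congr fun k => ?_
        simp only [Function.comp_apply, id, Nat.cast_mul, ← mul_smul]
        rcases Nat.eq_zero_or_pos k with rfl | hk
        · simp
        · field_simp)
  exact ⟨p, fun z => (hp z).symm ▸ hlim z⟩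

end IsLocalWeight

/-! ### Lower bounds for the exponent -/

/-- The projection of the lattice to the direction `θ`. -/
def projection (θ : EuclideanSpace ℝ (Fin d)) : (Fin d → ℤ) →+ ℝ :=
  (innerSL ℝ θ).toLinearMap.toAddMonoidHom.comp toEuclideanHom

lemma projection_apply (θ : EuclideanSpace ℝ (Fin d)) (z : Fin d → ℤ) :
    projection θ z = inner ℝ θ (toEuclidean z) := rfl

lemma projection_step (θ : EuclideanSpace ℝ (Fin d)) (a : Fin d × Bool) :
    projection θ (step a) = if a.2 then θ a.1 else -θ a.1 := by
  have : toEuclidean (step a) = EuclideanSpace.single a.1 (if a.2 then (1 : ℝ) else -1) := by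
    ext j
    by_cases h : j = a.1
    · subst h
      cases h2 : a.2 <;> simp [toEuclidean, step, h2]
    · simp [toEuclidean, step, h]
  rw [projection_apply, this, EuclideanSpace.inner_single_right]
  split_ifs <;> simp

lemma abs_projection_step_le {θ : EuclideanSpace ℝ (Fin d)} (hθ : ‖θ‖ = 1) (a : Fin d × Bool) :
    |projection θ (step a)| ≤ 1 := by
  have h := PiLp.norm_apply_le θ a.1
  rw [hθ, Real.norm_eq_abs] at h
  rw [projection_step]
  split_ifs
  · exact h
  · rwa [abs_neg]

lemma stepAvg_projection_sq [NeZero d] {θ : EuclideanSpace ℝ (Fin d)} (hθ : ‖θ‖ = 1) :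
    stepAvg (fun a => projection θ (step a) ^ 2) = 1 / d := by
  have hd : (d : ℝ) ≠ 0 := Nat.cast_ne_zero.2 (NeZero.ne d)
  have h : ∑ i, θ i ^ 2 = 1 := by
    have := EuclideanSpace.real_norm_sq_eq θ
    rw [hθ] at this
    linarith
  simp only [stepAvg, projection_step, Fintype.sum_prod_type, Fintype.sum_bool]
  simp only [if_true, Bool.false_eq_true, if_false, neg_sq, Finset.sum_add_distrib, h]
  field_simp
  norm_num

/-- Combine `cosh u ≤ exp(u² / 2)` with `exp τ ≤ 1 + τ + τ²` for `0 ≤ τ ≤ 1`; then `a ^ 2 / (2 * d)`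
is the leading term for small `a`. -/
lemma stepAvg_cosh_le_exp [NeZero d] {X : (Fin d → ℤ) →+ ℝ} (hX : ∀ a, |X (step a)| ≤ 1)
    (hX2 : stepAvg (fun a => X (step a) ^ 2) = 1 / d) {a c : ℝ} (ha : a ^ 2 ≤ 2)
    (hac : a ^ 2 / (2 * d) * (1 + a ^ 2 / 2) ≤ c) :
    stepAvg (fun s => Real.cosh (a * X (step s))) ≤ Real.exp c := by
  have hle : ∀ s : Fin d × Bool, Real.cosh (a * X (step s)) ≤
      1 + (1 + a ^ 2 / 2) * (a ^ 2 / 2) * X (step s) ^ 2 := by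
    intro s
    refine (Real.cosh_le_exp_half_sq _).trans ?_
    set t := (a * X (step s)) ^ 2 / 2 with ht
    have ht0 : 0 ≤ t := by positivity
    have hX1 : X (step s) ^ 2 ≤ 1 := by
      rw [← sq_abs]; exact pow_le_one₀ (abs_nonneg _) (hX s)
    have hta : t ≤ a ^ 2 / 2 := by
      rw [ht, mul_pow]; nlinarith [sq_nonneg a]
    have h1 := (abs_le.1 (Real.abs_exp_sub_one_sub_id_le
      (show |t| ≤ 1 by rw [abs_of_nonneg ht0]; linarith))).2
    have h2 : t ^ 2 ≤ a ^ 2 / 2 * t := by rw [sq]; exact mul_le_mul_of_nonneg_right hta ht0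
    have h3 : (1 + a ^ 2 / 2) * (a ^ 2 / 2) * X (step s) ^ 2 = (1 + a ^ 2 / 2) * t := by
      rw [ht]; ring
    rw [h3]
    linarith
  refine (stepAvg_mono hle).trans ?_
  rw [stepAvg_add, stepAvg_const, stepAvg_mul_left, hX2]
  have : (1 + a ^ 2 / 2) * (a ^ 2 / 2) * (1 / d) = a ^ 2 / (2 * d) * (1 + a ^ 2 / 2) := by
    field_simp
  rw [this]
  linarith [Real.add_one_le_exp c]

lemma IsSlabMajorant.mul_abs_le [NeZero d] {X : (Fin d → ℤ) →+ ℝ} {R ρ : ℝ}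
    {Ψ : ℝ → (Fin d → ℤ) → ((Fin d → ℤ) →₀ ℕ) → ℝ} (hΨ : IsSlabMajorant φ X R ρ Ψ)
    (hφ : IsLocalWeight φ) (hX : ∀ a, X (step a) ≤ 1) (hR : 1 ≤ R) (hρ0 : 0 < ρ) (hρ1 : ρ ≤ 1)
    {p : Seminorm ℝ (EuclideanSpace ℝ (Fin d))}
    (hp : ∀ z : Fin d → ℤ, Tendsto
      (fun k : ℕ => -Real.log (annealedSurvival φ (k • z)) / k) atTop (𝓝 (p (toEuclidean z))))
    (z : Fin d → ℤ) : -Real.log ρ / R * |X z| ≤ p (toEuclidean z) := by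
  have hR0 : 0 < R := one_pos.trans_le hR
  have hl : 0 ≤ -Real.log ρ := neg_nonneg.2 (Real.log_nonpos hρ0.le hρ1)
  have key : ∀ z, 0 ≤ X z → -Real.log ρ / R * X z ≤ p (toEuclidean z) := by
    intro z hz
    refine le_of_forall_nat_mul_le (D := -Real.log ρ) fun m => ?_
    have hlim : Tendsto (fun k : ℕ => (m : ℝ) *
        (-Real.log (annealedSurvival φ (k • z)) / k) + -Real.log ρ) atTop
        (𝓝 (m * p (toEuclidean z) + -Real.log ρ)) := ((hp z).const_mul _).add_const _
    refine ge_of_tendsto hlim ?_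
    filter_upwards [eventually_ge_atTop (m + 1)] with k hk
    have hk0 : (0 : ℝ) < k := Nat.cast_pos.2 (by omega)
    have hmk : (m : ℝ) ≤ k := Nat.cast_le.2 (by omega)
    -- The incomplete last slab loses at most one factor `ρ`, that is, `-log ρ` in total.
    set j := ⌊k * X z / R⌋₊
    have hj : (j : ℝ) * R ≤ X (k • z) := by
      rw [map_nsmul, nsmul_eq_mul, ← le_div_iff₀ hR0]
      exact Nat.floor_le (by positivity)
    have hs : annealedSurvival φ (k • z) ≤ ρ ^ j :=
      hφ.annealedSurvival_le fun n => hΨ.annealed_le_pow hφ hX hR n j hj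
    have hlog := Real.log_le_log (hφ.annealedSurvival_pos (k • z)) hs
    rw [Real.log_pow] at hlog
    have hj1 : k * X z / R - 1 ≤ j := by linarith [Nat.lt_floor_add_one (k * X z / R)]
    have h1 : (k * X z / R - 1) * -Real.log ρ ≤ -Real.log (annealedSurvival φ (k • z)) := by
      have := mul_le_mul_of_nonneg_right hj1 hl
      linarith
    have h2 : (m : ℝ) * ((k * X z / R - 1) * -Real.log ρ / k) ≤
        m * (-Real.log (annealedSurvival φ (k • z)) / k) :=
      mul_le_mul_of_nonneg_left (div_le_div_of_nonneg_right h1 hk0.le) (Nat.cast_nonneg m)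
    have h3 : (m : ℝ) * ((k * X z / R - 1) * -Real.log ρ / k) =
        m * (-Real.log ρ / R * X z) - m / k * -Real.log ρ := by
      field_simp
      ring
    have h4 : (m : ℝ) / k * -Real.log ρ ≤ -Real.log ρ :=
      mul_le_of_le_one_left hl ((div_le_one hk0).2 hmk)
    linarith
  rcases le_total 0 (X z) with h | h
  · rw [abs_of_nonneg h]; exact key z h
  · have := key (-z) (by rw [map_neg]; linarith)
    rw [← toEuclideanHom_apply, map_neg toEuclideanHom, map_neg_eq_map p, map_neg X] at this
    rwa [abs_of_nonpos h]

/-- Slabs orthogonal to `ℓ` itself give the seminorm `|⟨θ, ·⟩|`, up to the rate, as a lower bound on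
the lattice and hence everywhere; at `ℓ` it equals the norm. -/
lemma mul_norm_le_of_isSlabMajorant [NeZero d] (hφ : IsLocalWeight φ) {R ρ : ℝ}
    (hR : 1 ≤ R) (hρ0 : 0 < ρ) (hρ1 : ρ ≤ 1)
    (hΨ : ∀ θ : EuclideanSpace ℝ (Fin d), ‖θ‖ = 1 → ∃ Ψ, IsSlabMajorant φ (projection θ) R ρ Ψ)
    {p : Seminorm ℝ (EuclideanSpace ℝ (Fin d))}
    (hp : ∀ z : Fin d → ℤ, Tendsto
      (fun k : ℕ => -Real.log (annealedSurvival φ (k • z)) / k) atTop (𝓝 (p (toEuclidean z))))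
    (ℓ : EuclideanSpace ℝ (Fin d)) : -Real.log ρ / R * ‖ℓ‖ ≤ p ℓ := by
  rcases eq_or_ne ℓ 0 with rfl | hℓ
  · simp
  have hl : 0 ≤ -Real.log ρ / R :=
    div_nonneg (neg_nonneg.2 (Real.log_nonpos hρ0.le hρ1)) (by linarith)
  have hn : ‖ℓ‖ ≠ 0 := norm_ne_zero_iff.2 hℓ
  set θ := ‖ℓ‖⁻¹ • ℓ
  have hθ : ‖θ‖ = 1 := by simp [θ, norm_smul, hn]
  obtain ⟨Ψ, h⟩ := hΨ θ hθ
  let c : NNReal := ⟨-Real.log ρ / R, hl⟩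
  let q : Seminorm ℝ (EuclideanSpace ℝ (Fin d)) :=
    c • (normSeminorm ℝ ℝ).comp (innerSL ℝ θ).toLinearMap
  have hq : ∀ x, q x = -Real.log ρ / R * |inner ℝ θ x| := fun x => rfl
  have hle : q ≤ p := seminorm_le_of_lattice fun z => by
    rw [hq]
    exact h.mul_abs_le hφ (fun a => (abs_le.1 (abs_projection_step_le hθ a)).2) hR hρ0 hρ1 hp z
  have := hle ℓ
  rw [hq] at this
  refine le_trans (le_of_eq ?_) this
  congr 1
  simp only [θ, real_inner_smul_left, real_inner_self_eq_norm_sq]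
  rw [abs_of_nonneg (by positivity)]
  field_simp

lemma mul_norm_le_exponent [NeZero d] (hφ : IsLocalWeight φ)
    {p : Seminorm ℝ (EuclideanSpace ℝ (Fin d))}
    (hp : ∀ z : Fin d → ℤ, Tendsto
      (fun k : ℕ => -Real.log (annealedSurvival φ (k • z)) / k) atTop (𝓝 (p (toEuclidean z))))
    (ℓ : EuclideanSpace ℝ (Fin d)) : -Real.log (φ 1) * ‖ℓ‖ ≤ p ℓ := by
  simpa using mul_norm_le_of_isSlabMajorant hφ le_rfl (hφ.pos 1) (hφ.le_one 1)
    (fun θ hθ => ⟨_, isSlabMajorant_visited hφ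
      fun a => (abs_le.1 (abs_projection_step_le hθ a)).2⟩) hp ℓ

/-- In terms of `g = √γ`: if `φ k ≤ exp(-γ m k + γ² M² k² / 2)` and `s² / (2 * d)` is slightly smaller
than `m`, then slabs of width `K / g` are crossed at cost `t K`. -/
lemma rate_mul_norm_le_exponent [NeZero d] (hφ : IsLocalWeight φ) {g s t K M m : ℝ}
    (hg : 0 < g) (ht : 0 ≤ t) (hgK : g ≤ K) (hsg : (s * g) ^ 2 ≤ 2)
    (hm : s ^ 2 / (2 * d) * (1 + (s * g) ^ 2 / 2) ≤ m)
    (hφc : ∀ k : ℕ, φ k ≤ Real.exp (-(g ^ 2 * m) * k + (g ^ 2 * M) ^ 2 / 2 * (k : ℝ) ^ 2))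
    (hρ : Real.exp 1 / Real.cosh (s * (K - g)) +
      M ^ 2 / 2 * (d * (g * (g + 4 * d * (K + g)) * (K + 2 * g) ^ 2)) ≤ Real.exp (-(t * K)))
    {p : Seminorm ℝ (EuclideanSpace ℝ (Fin d))}
    (hp : ∀ z : Fin d → ℤ, Tendsto
      (fun k : ℕ => -Real.log (annealedSurvival φ (k • z)) / k) atTop (𝓝 (p (toEuclidean z))))
    (ℓ : EuclideanSpace ℝ (Fin d)) : t * ‖ℓ‖ ≤ p ℓ / g := by
  have hK : 0 < K := hg.trans_le hgK
  have hR : 1 ≤ K / g := (one_le_div hg).2 hgK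
  -- This is the slab factor for `R = K / g`, `a = s * g`, `η = (g ^ 2 * M) ^ 2 / 2`. Of `g ^ 4` in
  -- `η`, three powers cancel against the cubic growth in `R`, and one power of `g` survives.
  set ρ := Real.exp 1 / Real.cosh (s * g * (K / g - 1)) +
    (g ^ 2 * M) ^ 2 / 2 * (d * (1 + 4 * d * (K / g + 1)) * (K / g + 2) ^ 2) with hρdef
  have hρeq : ρ = Real.exp 1 / Real.cosh (s * (K - g)) +
      M ^ 2 / 2 * (d * (g * (g + 4 * d * (K + g)) * (K + 2 * g) ^ 2)) := by
    rw [hρdef, show s * g * (K / g - 1) = s * (K - g) by field_simp]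
    congr 1
    field_simp
  have hρ0 : 0 < ρ := by
    have := Real.cosh_pos (s * g * (K / g - 1))
    rw [hρdef]
    positivity
  have hρt : ρ ≤ Real.exp (-(t * K)) := hρeq ▸ hρ
  have hρ1 : ρ ≤ 1 := hρt.trans (Real.exp_le_one_iff.2 (neg_nonpos.2 (by positivity)))
  have h := mul_norm_le_of_isSlabMajorant hφ hR hρ0 hρ1 (fun θ hθ =>
    ⟨_, isSlabMajorant_slabMajorant (a := s * g) hφ (abs_projection_step_le hθ)
      (stepAvg_projection_sq hθ) hR (by positivity) hφc
      (stepAvg_cosh_le_exp (abs_projection_step_le hθ) (stepAvg_projection_sq hθ) hsg (by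
        have := mul_le_mul_of_nonneg_left hm (sq_nonneg g)
        refine le_trans (le_of_eq ?_) this
        ring))⟩) hp ℓ
  have hlog : t * K ≤ -Real.log ρ := by
    have := Real.log_le_log hρ0 hρt
    rw [Real.log_exp] at this
    linarith
  rw [le_div_iff₀ hg]
  refine le_trans ?_ h
  have h2 : t * g ≤ -Real.log ρ / (K / g) := by
    rw [le_div_iff₀ (by positivity)]
    refine le_trans (le_of_eq ?_) hlog
    field_simp
  nlinarith [norm_nonneg ℓ]

/-! ### The Laplace transform of small potentials -/

/-- Because `(1 + x + x²/2) * (1 - x + x²/2) = 1 + x⁴/4 ≥ 1`. -/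
lemma exp_neg_le_quadratic {x : ℝ} (hx : 0 ≤ x) : Real.exp (-x) ≤ 1 - x + x ^ 2 / 2 := by
  rw [Real.exp_neg]
  refine inv_le_of_inv_le₀ (by nlinarith [sq_nonneg (x - 1)]) ?_
  refine le_trans ?_ (Real.quadratic_le_exp_of_nonneg hx)
  rw [inv_le_iff_one_le_mul₀ (by nlinarith [sq_nonneg (x - 1)])]
  nlinarith [sq_nonneg (x ^ 2)]

section

variable {Ω : Type*} [MeasurableSpace Ω] {P : Measure Ω} [IsProbabilityMeasure P]

lemma laplace_le_exp {W w : Ω → ℝ} (hW : Measurable W) (hw : Measurable w)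
    (hw0 : ∀ ω, 0 ≤ w ω) (hwW : ∀ ω, w ω ≤ W ω) {b : ℝ} (hwb : ∀ ω, w ω ≤ b) (k : ℕ) :
    laplace P W k ≤ Real.exp (-(∫ ω, w ω ∂P) * k + b ^ 2 / 2 * (k : ℝ) ^ 2) := by
  have hInt : Integrable w P := Integrable.of_bound hw.aestronglyMeasurable b
    (Eventually.of_forall fun ω => by
      rw [Real.norm_eq_abs, abs_of_nonneg (hw0 ω)]; exact hwb ω)
  have hle : ∀ ω, Real.exp (-(k * W ω)) ≤ 1 - k * w ω + b ^ 2 / 2 * (k : ℝ) ^ 2 := by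
    intro ω
    have h1 : (k : ℝ) * w ω ≤ k * W ω := mul_le_mul_of_nonneg_left (hwW ω) (Nat.cast_nonneg k)
    refine (Real.exp_le_exp.2 (neg_le_neg h1)).trans
      ((exp_neg_le_quadratic (mul_nonneg (Nat.cast_nonneg k) (hw0 ω))).trans ?_)
    have h2 : w ω ^ 2 ≤ b ^ 2 := pow_le_pow_left₀ (hw0 ω) (hwb ω) 2
    nlinarith [sq_nonneg (k : ℝ)]
  have h := integral_mono (μ := P) (integrable_exp_neg (hW.const_mul (k : ℝ))
      fun ω => mul_nonneg (Nat.cast_nonneg k) ((hw0 ω).trans (hwW ω)))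
    (((integrable_const 1).sub (hInt.const_mul (k : ℝ))).add (integrable_const _)) hle
  refine h.trans (le_trans (le_of_eq ?_) (Real.add_one_le_exp _))
  have hk := hInt.const_mul (k : ℝ)
  change ∫ ω, (1 - k * w ω + b ^ 2 / 2 * (k : ℝ) ^ 2) ∂P = _
  rw [integral_add (f := fun ω => 1 - k * w ω) ((integrable_const 1).sub hk) (integrable_const _),
    integral_sub (integrable_const 1) hk, integral_const_mul]
  simp
  ring

lemma laplace_one_lt_one {W : Ω → ℝ} (hW : Measurable W) (h0 : ∀ ω, 0 ≤ W ω)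
    (hP : P {ω | 0 < W ω} ≠ 0) : laplace P W 1 < 1 := by
  have hInt := integrable_exp_neg (P := P) hW h0
  have hnn : 0 ≤ fun ω => 1 - Real.exp (-W ω) := fun ω =>
    sub_nonneg.2 (Real.exp_le_one_iff.2 (neg_nonpos.2 (h0 ω)))
  have hsupp : Function.support (fun ω => 1 - Real.exp (-W ω)) = {ω | 0 < W ω} := by
    ext ω
    simp only [Function.mem_support, Set.mem_ofPred_eq, ne_eq, sub_eq_zero, eq_comm (a := (1 : ℝ)),
      Real.exp_eq_one_iff, neg_eq_zero]
    exact ⟨fun h => lt_of_le_of_ne (h0 ω) (Ne.symm h), fun h => h.ne'⟩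
  have h := (integral_pos_iff_support_of_nonneg hnn ((integrable_const 1).sub hInt)).2
    (by rw [hsupp]; exact pos_iff_ne_zero.2 hP)
  rw [integral_sub (integrable_const 1) hInt] at h
  simp only [integral_const, probReal_univ, one_smul] at h
  simp only [laplace, Nat.cast_one, one_mul]
  linarith

end

lemma IsIIDPotential.isAnnealedExponent_iff [NeZero d] {Ω : Type*} [MeasurableSpace Ω]
    {P : Measure Ω} [IsProbabilityMeasure P] {V : (Fin d → ℤ) → Ω → ℝ} (hV : IsIIDPotential P V)
    (p : Seminorm ℝ (EuclideanSpace ℝ (Fin d))) :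
    IsAnnealedExponent P V p ↔ ∀ z : Fin d → ℤ, Tendsto
      (fun k : ℕ => -Real.log (annealedSurvival (laplace P (V 0)) (k • z)) / k) atTop
        (𝓝 (p (toEuclidean z))) := by
  refine forall_congr' fun z => ?_
  simp only [hV.integral_survival]
  refine iff_of_eq (congrArg (fun f => Tendsto f atTop _) (funext fun k => ?_))
  ring

/-! ### Truncated means -/

/-- The truncation `x ↦ min(x, M)⁺`. -/
def truncate (M x : ℝ) : ℝ := max 0 (min x M)

lemma truncate_nonneg (M x : ℝ) : 0 ≤ truncate M x := le_max_left _ _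

lemma truncate_le {M : ℝ} (hM : 0 ≤ M) (x : ℝ) : truncate M x ≤ M :=
  max_le hM (min_le_right _ _)

lemma truncate_le_self (M : ℝ) {x : ℝ} (hx : 0 ≤ x) : truncate M x ≤ x :=
  max_le hx (min_le_left _ _)

lemma continuous_truncate (M : ℝ) : Continuous (truncate M) := by
  unfold truncate; fun_prop

/-- Truncation supplies a bounded continuous test function, so convergence in distribution suffices
even when means are infinite. -/
lemma tendsto_integral_truncate {ι Ω' : Type*} {Ω : ι → Type*} [∀ i, MeasurableSpace (Ω i)]
    {P : (i : ι) → Measure (Ω i)} [∀ i, IsProbabilityMeasure (P i)] [MeasurableSpace Ω']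
    {P' : Measure Ω'} [IsProbabilityMeasure P'] {X : (i : ι) → Ω i → ℝ} {Z : Ω' → ℝ}
    {l : Filter ι} (h : TendstoInDistribution X l Z P P') {M : ℝ} (hM : 0 ≤ M) :
    Tendsto (fun i => ∫ ω, truncate M (X i ω) ∂P i) l (𝓝 (∫ ω, truncate M (Z ω) ∂P')) := by
  let f : BoundedContinuousFunction ℝ ℝ := BoundedContinuousFunction.ofNormedAddCommGroup
    (truncate M) (continuous_truncate M) M fun x => by
      rw [Real.norm_eq_abs, abs_of_nonneg (truncate_nonneg M x)]
      exact truncate_le hM x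
  have := ProbabilityMeasure.tendsto_iff_forall_integral_tendsto.1 h.tendsto f
  simp only [ProbabilityMeasure.coe_mk, f,
    BoundedContinuousFunction.coe_ofNormedAddCommGroup] at this
  rw [integral_map h.aemeasurable_limit (continuous_truncate M).aestronglyMeasurable] at this
  refine this.congr fun i => ?_
  exact integral_map (h.forall_aemeasurable i) (continuous_truncate M).aestronglyMeasurable

lemma exists_lt_integral_truncate {Ω : Type*} [MeasurableSpace Ω] {P : Measure Ω}
    [IsProbabilityMeasure P] {Z : Ω → ℝ} (hZ : AEMeasurable Z P) {c r : ℝ} (hc : 0 ≤ c)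
    (h : ENNReal.ofReal r < ENNReal.ofReal c * ∫⁻ ω, ENNReal.ofReal (Z ω) ∂P) :
    ∃ M : ℝ, 0 ≤ M ∧ r < c * ∫ ω, truncate M (Z ω) ∂P := by
  have hmeas : ∀ M, AEMeasurable (fun ω => truncate M (Z ω)) P := fun M =>
    (continuous_truncate M).measurable.comp_aemeasurable hZ
  have htend : Tendsto (fun n : ℕ => ∫⁻ ω, ENNReal.ofReal (truncate n (Z ω)) ∂P) atTop
      (𝓝 (∫⁻ ω, ENNReal.ofReal (Z ω) ∂P)) := by
    refine lintegral_tendsto_of_tendsto_of_monotone (fun n => (hmeas n).ennreal_ofReal)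
      (Eventually.of_forall fun ω m n hmn => ?_) (Eventually.of_forall fun ω => ?_)
    · refine ENNReal.ofReal_le_ofReal (max_le_max le_rfl (min_le_min le_rfl ?_))
      exact Nat.cast_le.2 hmn
    · refine tendsto_const_nhds.congr' ?_
      obtain ⟨N, hN⟩ := exists_nat_ge (Z ω)
      filter_upwards [eventually_ge_atTop N] with n hn
      rw [truncate, min_eq_left (hN.trans (Nat.cast_le.2 hn)), max_comm, ENNReal.ofReal_max]
      simp
  have htend' := ENNReal.Tendsto.const_mul (a := ENNReal.ofReal c) htend
    (Or.inr ENNReal.ofReal_ne_top)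
  obtain ⟨n, hn⟩ := (htend'.eventually_const_lt h).exists
  refine ⟨n, Nat.cast_nonneg n, ?_⟩
  have hInt : Integrable (fun ω => truncate n (Z ω)) P :=
    Integrable.of_bound (hmeas n).aestronglyMeasurable n (Eventually.of_forall fun ω => by
      rw [Real.norm_eq_abs, abs_of_nonneg (truncate_nonneg _ _)]
      exact truncate_le (Nat.cast_nonneg n) _)
  rw [← ofReal_integral_eq_lintegral_ofReal hInt
    (Eventually.of_forall fun ω => truncate_nonneg _ _), ← ENNReal.ofReal_mul hc] at hn
  exact (ENNReal.ofReal_lt_ofReal_iff'.1 hn).1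

/-- For wide slabs the crossing factor is, in the limit `g → 0`, below `exp(-t K)`. -/
lemma exists_width_eventually_le {s t : ℝ} (hst : t < s) (D : ℝ) (M : ℝ) :
    ∃ K > 0, ∀ᶠ g in 𝓝 (0 : ℝ), Real.exp 1 / Real.cosh (s * (K - g)) +
      M ^ 2 / 2 * (D * (g * (g + 4 * D * (K + g)) * (K + 2 * g) ^ 2)) ≤ Real.exp (-(t * K)) := by
  -- Then `exp((s - t) * K) = e²`, which beats the constant `2 * e` in `e / cosh(s K) < 2 e exp(-s
  -- K)`, because `2 < e`. At `g = 0` the self-intersection term vanishes, and continuity does the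
  -- rest.
  set K := 2 / (s - t) with hKdef
  have hst' : 0 < s - t := sub_pos.2 hst
  have hK : 0 < K := by positivity
  refine ⟨K, hK, ?_⟩
  have hcont : ContinuousAt (fun g : ℝ => Real.exp 1 / Real.cosh (s * (K - g)) +
      M ^ 2 / 2 * (D * (g * (g + 4 * D * (K + g)) * (K + 2 * g) ^ 2))) 0 := by
    refine ContinuousAt.add (ContinuousAt.div₀ (by fun_prop) ?_ (Real.cosh_pos _).ne') (by fun_prop)
    exact (Real.continuous_cosh.comp (by fun_prop)).continuousAt
  have hlt : Real.exp 1 / Real.cosh (s * K) < Real.exp (-(t * K)) := by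
    rw [div_lt_iff₀ (Real.cosh_pos _), Real.cosh_eq]
    have h1 : Real.exp (-(t * K)) * Real.exp (s * K) = Real.exp 1 * Real.exp 1 := by
      rw [← Real.exp_add, ← Real.exp_add]
      congr 1
      rw [hKdef]
      field_simp
      ring
    have h2 : 0 < Real.exp (-(t * K)) * Real.exp (-(s * K)) := by positivity
    have h3 : 2 < Real.exp 1 := by linarith [Real.exp_one_gt_d9]
    nlinarith
  have h0 := hcont.tendsto
  simp only [sub_zero, zero_mul, mul_zero, add_zero] at h0
  exact (h0.eventually_lt_const hlt).mono fun g hg => hg.le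

/-- The main asymptotic estimate. -/
lemma eventually_mul_norm_le_exponent [NeZero d]
    {Ω : Set.Ioi (0 : ℝ) → Type*} [∀ γ, MeasurableSpace (Ω γ)]
    {P : (γ : Set.Ioi (0 : ℝ)) → Measure (Ω γ)} [∀ γ, IsProbabilityMeasure (P γ)]
    {V : (γ : Set.Ioi (0 : ℝ)) → (Fin d → ℤ) → Ω γ → ℝ} (hV : ∀ γ, IsIIDPotential (P γ) (V γ))
    {Ω' : Type*} [MeasurableSpace Ω'] {P' : Measure Ω'} [IsProbabilityMeasure P'] {V' : Ω' → ℝ}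
    (hlim : TendstoInDistribution (fun γ ω => V γ 0 ω / (γ : ℝ))
      (comap (Subtype.val : Set.Ioi (0 : ℝ) → ℝ) (𝓝[>] 0)) V' P P')
    {β : Set.Ioi (0 : ℝ) → Seminorm ℝ (EuclideanSpace ℝ (Fin d))}
    (hβ : ∀ γ, IsAnnealedExponent (P γ) (V γ) (β γ)) {s t M : ℝ} (ht : 0 ≤ t) (hts : t < s)
    (hM : 0 ≤ M) (hs : s ^ 2 < 2 * d * ∫ ω, truncate M (V' ω) ∂P')
    (ℓ : EuclideanSpace ℝ (Fin d)) :
    ∀ᶠ γ in comap (Subtype.val : Set.Ioi (0 : ℝ) → ℝ) (𝓝[>] 0),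
      t * ‖ℓ‖ ≤ β γ ℓ / Real.sqrt (γ : ℝ) := by
  have hd : (0 : ℝ) < d := Nat.cast_pos.2 (Nat.pos_of_ne_zero (NeZero.ne d))
  set l := comap (Subtype.val : Set.Ioi (0 : ℝ) → ℝ) (𝓝[>] 0)
  obtain ⟨K, hK, hρ⟩ := exists_width_eventually_le hts d M
  have hg : Tendsto (fun γ : Set.Ioi (0 : ℝ) => Real.sqrt γ) l (𝓝 0) := by
    have : Tendsto (Subtype.val : Set.Ioi (0 : ℝ) → ℝ) l (𝓝 0) :=
      tendsto_comap.mono_right nhdsWithin_le_nhds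
    have h := (Real.continuous_sqrt.tendsto 0).comp this
    rwa [Real.sqrt_zero] at h
  have hsg : Tendsto (fun g : ℝ => (s * g) ^ 2) (𝓝 0) (𝓝 0) := by
    have : Continuous fun g : ℝ => (s * g) ^ 2 := by fun_prop
    simpa using this.tendsto 0
  have hmean : Tendsto (fun g : ℝ => s ^ 2 / (2 * d) * (1 + (s * g) ^ 2 / 2)) (𝓝 0)
      (𝓝 (s ^ 2 / (2 * d))) := by
    have : Continuous fun g : ℝ => s ^ 2 / (2 * d) * (1 + (s * g) ^ 2 / 2) := by fun_prop
    simpa using this.tendsto 0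
  have hlt : s ^ 2 / (2 * d) < ∫ ω, truncate M (V' ω) ∂P' := by
    rw [div_lt_iff₀ (by positivity)]
    linarith
  filter_upwards [hg.eventually hρ, hg.eventually_le_const hK,
    hg.eventually (hsg.eventually_le_const two_pos),
    (hmean.comp hg).eventually_lt (tendsto_integral_truncate hlim hM) hlt]
    with γ h1 h2 h3 h4
  have hγ : (0 : ℝ) < γ := γ.2
  have hsq : Real.sqrt γ ^ 2 = (γ : ℝ) := Real.sq_sqrt hγ.le
  refine rate_mul_norm_le_exponent
    (isLocalWeight_laplace ((hV γ).measurable 0) ((hV γ).nonneg 0)) (M := M)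
    (Real.sqrt_pos.2 hγ) ht h2 h3 h4.le (fun k => ?_) h1
    (((hV γ).isAnnealedExponent_iff _).1 (hβ γ)) ℓ
  rw [hsq]
  -- Truncating at scale `γ * M` keeps the variable below `V γ 0` and gives mean `γ m` and bound `γ
  -- M`.
  have := laplace_le_exp (P := P γ) (W := V γ 0)
    (w := fun ω => (γ : ℝ) * truncate M (V γ 0 ω / γ)) (b := γ * M) ((hV γ).measurable 0)
    (((continuous_truncate M).measurable.comp (((hV γ).measurable 0).div_const _)).const_mul _)
    (fun ω => mul_nonneg hγ.le (truncate_nonneg _ _))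
    (fun ω => by
      have := mul_le_mul_of_nonneg_left
        (truncate_le_self M (div_nonneg ((hV γ).nonneg 0 ω) hγ.le)) hγ.le
      rwa [mul_div_cancel₀ _ hγ.ne'] at this)
    (fun ω => mul_le_mul_of_nonneg_left (truncate_le hM _) hγ.le) k
  rwa [integral_const_mul] at this

end RandomPotential

end

theorem mainTheorem4 {d : ℕ} [NeZero d]
    {Ω : Set.Ioi (0 : ℝ) → Type*} [∀ γ, MeasurableSpace (Ω γ)]
    (P : (γ : Set.Ioi (0 : ℝ)) → Measure (Ω γ)) [∀ γ, IsProbabilityMeasure (P γ)]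
    (V : (γ : Set.Ioi (0 : ℝ)) → (Fin d → ℤ) → Ω γ → ℝ)
    (hV : ∀ γ, RandomPotential.IsIIDPotential (P γ) (V γ))
    {Ω' : Type*} [MeasurableSpace Ω'] (P' : Measure Ω') [IsProbabilityMeasure P']
    (V' : Ω' → ℝ)
    (hlim : TendstoInDistribution (fun γ ω => V γ 0 ω / (γ : ℝ))
      (comap (Subtype.val : Set.Ioi (0 : ℝ) → ℝ) (𝓝[>] 0)) V' P P') :
    ∃ β : Set.Ioi (0 : ℝ) → Seminorm ℝ (EuclideanSpace ℝ (Fin d)),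
      (∀ γ p, RandomPotential.IsAnnealedExponent (P γ) (V γ) p ↔ p = β γ) ∧
      (∀ γ, P γ {ω | 0 < V γ 0 ω} ≠ 0 → ∀ ℓ, ℓ ≠ 0 → 0 < β γ ℓ) ∧
      ∀ ℓ : EuclideanSpace ℝ (Fin d),
        (2 * (d : ℝ≥0∞) * ∫⁻ ω, ENNReal.ofReal (V' ω) ∂P') ^ (1 / 2 : ℝ) * ENNReal.ofReal ‖ℓ‖ ≤
          liminf (fun γ : Set.Ioi (0 : ℝ) => ENNReal.ofReal (β γ ℓ / Real.sqrt (γ : ℝ)))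
            (comap (Subtype.val : Set.Ioi (0 : ℝ) → ℝ) (𝓝[>] 0)) := by
  have hφ := fun γ =>
    RandomPotential.isLocalWeight_laplace (P := P γ) ((hV γ).measurable 0) ((hV γ).nonneg 0)
  choose β hβ using fun γ => (hφ γ).exists_seminorm_tendsto (d := d)
  have hexp : ∀ γ, RandomPotential.IsAnnealedExponent (P γ) (V γ) (β γ) := fun γ =>
    ((hV γ).isAnnealedExponent_iff _).2 (hβ γ)
  refine ⟨β, fun γ p => ⟨fun hp => ?_, fun hp => hp ▸ hexp γ⟩, fun γ hP ℓ hℓ => ?_, fun ℓ => ?_⟩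
  · exact RandomPotential.seminorm_eq_of_lattice fun z => tendsto_nhds_unique (hp z) (hexp γ z)
  · have h1 := RandomPotential.laplace_one_lt_one ((hV γ).measurable 0) ((hV γ).nonneg 0) hP
    have h2 := RandomPotential.mul_norm_le_exponent (hφ γ) (hβ γ) ℓ
    exact (mul_pos (neg_pos.2 (Real.log_neg ((hφ γ).pos 1) h1)) (norm_pos_iff.2 hℓ)).trans_le h2
  · refine ENNReal.mul_le_of_forall_lt fun a ha b hb => ?_
    -- Here `a` and `c` become the speeds `t < s`: the gap between them pays for the constants of a
    -- slab, and the gap above `c` leaves room for a truncation level `M`.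
    obtain ⟨c, hac, hc⟩ := exists_between ha
    have hctop : c ≠ ⊤ := ne_top_of_lt hc
    have hatop : a ≠ ⊤ := ne_top_of_lt hac
    have hsq : ENNReal.ofReal (c.toReal ^ 2) <
        ENNReal.ofReal (2 * d) * ∫⁻ ω, ENNReal.ofReal (V' ω) ∂P' := by
      rw [ENNReal.ofReal_pow ENNReal.toReal_nonneg, ENNReal.ofReal_toReal hctop,
        ENNReal.ofReal_mul zero_le_two, ENNReal.ofReal_natCast, ENNReal.ofReal_ofNat]
      rw [one_div, ENNReal.lt_rpow_inv_iff (by norm_num)] at hc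
      exact_mod_cast hc
    obtain ⟨M, hM, hs⟩ := RandomPotential.exists_lt_integral_truncate hlim.aemeasurable_limit
      (by positivity : (0 : ℝ) ≤ 2 * d) hsq
    refine le_liminf_of_le (by isBoundedDefault) ?_
    filter_upwards [RandomPotential.eventually_mul_norm_le_exponent hV hlim hexp
      ENNReal.toReal_nonneg ((ENNReal.toReal_lt_toReal hatop hctop).2 hac) hM hs ℓ] with γ hγ
    calc a * b ≤ a * ENNReal.ofReal ‖ℓ‖ := by gcongr
      _ = ENNReal.ofReal (a.toReal * ‖ℓ‖) := by
        rw [ENNReal.ofReal_mul ENNReal.toReal_nonneg, ENNReal.ofReal_toReal hatop]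
      _ ≤ _ := ENNReal.ofReal_le_ofReal hγ
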